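/- **Setting.** Let $\alpha\in 2\pi(\mathbb R\setminus\mathbb Q)$, $X=\mathbb R/2\pi\mathbb Z$ with normalized Lebesgue measure $\mu$ and $Tx=x+\alpha$. On $L^2(X,\mu)$ let $\lambda_1 v=v\circ T$, let $M_fv=fv$ for $f\in C(X)$, and write $e^{inx}$ for $M_{e^{inx}}$. Let $C^*_r(\mathbb Z)$ be the $C^*$-algebra generated by $\lambda_1$, and let $\mathcal C=C(X)\rtimes_r\mathbb Z$ be realized as the $C^*$-algebra generated by $\lambda_1$ and all $M_f$. Let $S^1=\mathbb R/2\pi\mathbb Z$, $\tau t=t+\alpha$, and let $\phi\mapsto\hat\phi$ be the isomorphism $C(S^1)\cong C^*_r(\mathbb Z)$ with $\widehat{e^{it}}=\lambda_1$. An *intermediate algebra* is a $C^*$-algebra $\mathcal A$ with $C^*_r(\mathbb Z)\subseteq\mathcal A\subseteq\mathcal C$. Its *ideal function* is $\mathfrak c(n)=\{\eta\in C^*_r(\mathbb Z): e^{inx}\eta\in\mathcal A\}$, $n\in\mathbb Z$, a closed ideal of $C^*_r(\mathbb Z)$; let $\check{\mathfrak c}(n)\subseteq S^1$ be the closed set of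 common zeros of all $\phi$ with $\hat\phi\in\mathfrak c(n)$, and $\operatorname{Supp}(\mathfrak c)=\{n:\mathfrak c(n)\neq(0)\}$. $\mathcal A$ is *small* if $\operatorname{Supp}(\mathfrak c)$ is finite; $\mathcal A$ is *residual* if $\mathcal A\ne C^*_r(\mathbb Z)$ and $\check{\mathfrak c}(n)$ is nowhere dense for every $n\in\operatorname{Supp}(\mathfrak c)$. For $q\in\mathbb N=\{0,1,2,\dots\}$ and a closed $P\subseteq S^1$, the *basic algebra* $\mathcal A_{q,P}$ is the closed $*$-algebra generated by all $e^{imx}\hat\phi$ with $m\in\mathbb Z$ and $\phi$ vanishing on $\check{\mathfrak b}_{q,P}(m)$, where $\check{\mathfrak b}_{q,P}(0)=\emptyset$, $\check{\mathfrak b}_{q,P}(nq)=\bigcup_{j=0}^{n-1}\tau^{-jq}P$ and $\check{\mathfrak b}_{q,P}(-nq)=\bigcup_{j=1}^{n}\tau^{jq}P$ for $n,q\ge1$, and $\check{\mathfrak b}_{q,P}(m)=S^1$ if $q\nmid m$ (so $\mathcal A_{0,P}=C^*_r(\mathbb Z)$). The join $\mathcal A_1\vee\mathcal A_2$ is the closure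 of the algebra generated by $\mathcal A_1\cup\mathcal A_2$. **Proposition.** 1. If $\mathcal A$ is small with ideal function $\mathfrak c$, then $\check{\mathfrak c}(n)$ has nonempty interior for every $n\neq0$. In particular a small algebra is never residual. 2. For all $q\in\mathbb N$ and closed $P\subseteq S^1$: $\mathcal A_{q,P}$ is small if and only if it is not residual. 3. If $\mathcal A$ is small, then it is finite dimensional as a module over $C^*_r(\mathbb Z)$, in the following sense: $\mathcal A=\bigoplus_{n\in\operatorname{Supp}(\mathfrak c)}e^{inx}\mathfrak c(n)$, i.e. the elements of $\mathcal A$ are exactly the finite sums $\sum_{n\in\operatorname{Supp}(\mathfrak c)}e^{inx}\eta_n$ with $\eta_n\in\mathfrak c(n)$, with uniquely determined $\eta_n$; the module $\mathcal A$ (under left multiplication) is topologically finitely generated (some finite subset spans a dense $C^*_r(\mathbb Z)$-submodule); and it has finite rank, i.e. the cardinalities of its $C^*_r(\mathbb Z)$-linearly independent subsets are bounded by a natural number. 4. Many small algebras have a nontrivial center: if $P\subsetneq S^1$ is closed and $P\cup\tau P=S^1$, then $\mathcal A_{1,P}$ is small, noncommutative, and its center is not $\mathbb C1$; and the set of all small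 noncommutative intermediate algebras with center different from $\mathbb C1$ is uncountable. 5. There are small intermediate algebras $\mathcal A_1,\mathcal A_2$ such that $\mathcal A_1\vee\mathcal A_2$ is not small. -/

import Mathlib

open MeasureTheory Set
open scoped Real ENNReal

noncomputable section

namespace RotationAlgebra

instance factTwoPiPos : Fact (0 < 2 * π) := ⟨Real.two_pi_pos⟩

/-- The phase space `X = ℝ / 2πℤ`. -/
abbrev X : Type := AddCircle (2 * π)

/-- The dual circle `S¹ = ℝ / 2πℤ`, the Gelfand spectrum of `C*_r(ℤ)`. -/
abbrev S1 : Type := AddCircle (2 * π)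

/-- `L²(X, μ)`, with `μ` the normalized Lebesgue measure `dx / 2π`. -/
abbrev H : Type := Lp ℂ 2 (AddCircle.haarAddCircle : Measure X)

/-- The bounded operators on `L²(X, μ)`. -/
abbrev B : Type := H →L[ℂ] H

/-- The multiplication operator `M_f : v ↦ f v` for `f ∈ C(X)`. -/
def mulOp (f : C(X, ℂ)) : B :=
  (ContinuousLinearMap.mul ℂ ℂ).holderL AddCircle.haarAddCircle ∞ 2 2
    (ContinuousMap.toLp ∞ AddCircle.haarAddCircle ℂ f)

theorem mulOp_coeFn (f : C(X, ℂ)) (v : H) :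
    mulOp f v =ᵐ[AddCircle.haarAddCircle] fun x => f x * v x := by
  have h1 := (ContinuousLinearMap.mul ℂ ℂ).coeFn_holder (r := 2)
    (ContinuousMap.toLp ∞ AddCircle.haarAddCircle ℂ f) v
  have h2 := ContinuousMap.coeFn_toLp (p := ∞) (𝕜 := ℂ)
    (AddCircle.haarAddCircle : Measure X) f
  filter_upwards [h1, h2] with x hx1 hx2
  rw [← hx2]
  exact hx1

theorem measurePreserving_rotation (s : X) :
    MeasurePreserving (fun x : X => x + s) AddCircle.haarAddCircle AddCircle.haarAddCircle :=
  measurePreserving_add_right _ s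

/-- The Koopman operator of the rotation by `α`, namely `v ↦ v ∘ T` with `T x = x + α`,
as a surjective linear isometry of `L²(X, μ)`. -/
def koopmanEquiv (α : ℝ) : H ≃ₗᵢ[ℂ] H :=
  LinearIsometryEquiv.ofSurjective
    (Lp.compMeasurePreservingₗᵢ ℂ (fun x : X => x + (α : X))
      (measurePreserving_rotation (α : X)))
    (by
      intro v
      refine ⟨Lp.compMeasurePreserving (fun x : X => x + -(α : X))
        (measurePreserving_rotation (-(α : X))) v, ?_⟩
      apply Lp.ext
      refine (Lp.coeFn_compMeasurePreserving _ (measurePreserving_rotation (α : X))).trans ?_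
      have h := (measurePreserving_rotation (α : X)).quasiMeasurePreserving.ae_eq_comp
        (Lp.coeFn_compMeasurePreserving v (measurePreserving_rotation (-(α : X))))
      refine h.trans (Filter.Eventually.of_forall fun x => ?_)
      simp [Function.comp])

/-- The unitary `λ₁ = U_T` on `L²(X, μ)`. -/
def koopmanUnitary (α : ℝ) : unitary B :=
  Unitary.linearIsometryEquiv.symm (koopmanEquiv α)

/-- `λ₁ = U_T` as an operator. -/
def lam (α : ℝ) : B := koopmanUnitary α

theorem lam_coeFn (α : ℝ) (v : H) :
    lam α v =ᵐ[AddCircle.haarAddCircle] fun x => v (x + (α : X)) :=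
  Lp.coeFn_compMeasurePreserving v (measurePreserving_rotation (α : X))

instance (α : ℝ) : IsStarNormal (lam α) := by
  unfold lam; infer_instance

/-- `C*_r(ℤ)`, realized as the unital C*-algebra generated by `λ₁`. -/
abbrev CstarZ (α : ℝ) : StarSubalgebra ℂ B := StarAlgebra.elemental ℂ (lam α)

instance (α : ℝ) : CommRing (CstarZ α) := inferInstance

set_option synthInstance.maxHeartbeats 200000 in
instance (α : ℝ) : IsTopologicalRing (CstarZ α) := inferInstance

/-- Left multiplication makes `B(L²(X, μ))` a module over `C*_r(ℤ)`. -/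
instance (α : ℝ) : Module (CstarZ α) B :=
  Module.compHom B ((CstarZ α).subtype : CstarZ α →+* B)

instance (α : ℝ) : DistribMulAction (CstarZ α) B := Module.toDistribMulAction
instance (α : ℝ) : MulAction (CstarZ α) B := DistribMulAction.toMulAction
instance (α : ℝ) : SMul (CstarZ α) B := MulAction.toSemigroupAction.toSMul

theorem smul_eq_mul (α : ℝ) (η : CstarZ α) (a : B) : η • a = (η : B) * a := rfl

instance (α : ℝ) : ContinuousConstSMul (CstarZ α) B :=
  ⟨fun _ => continuous_const.mul continuous_id⟩

/-- The crossed product `𝒞 = C(X) ⋊_r ℤ`, realized as the C*-subalgebra of `B(L²(X, μ))`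
generated by the Koopman operator and the multiplication operators. -/
def crossedProduct (α : ℝ) : StarSubalgebra ℂ B :=
  (StarAlgebra.adjoin ℂ (insert (lam α) (range mulOp))).topologicalClosure

theorem CstarZ_le_crossedProduct (α : ℝ) : CstarZ α ≤ crossedProduct α :=
  StarAlgebra.elemental.le_of_mem (StarSubalgebra.isClosed_topologicalClosure _)
    (StarSubalgebra.le_topologicalClosure _
      (StarAlgebra.subset_adjoin _ _ (mem_insert _ _)))

/-- The spectrum of the unitary `λ₁` is a subset of the unit circle, which is identified with
`S¹ = ℝ / 2πℤ` through `t ↦ e^{it}`. -/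
def spectrumToCircle (α : ℝ) : C(spectrum ℂ (lam α), S1) where
  toFun z := AddCircle.homeomorphCircle'.symm
    ⟨z.1, spectrum.subset_circle_of_unitary (koopmanUnitary α).2 z.2⟩
  continuous_toFun := AddCircle.homeomorphCircle'.symm.continuous.comp
    (continuous_subtype_val.subtype_mk _)

/-- The map `φ ↦ φ̂` from `C(S¹)` to `C*_r(ℤ)`: the continuous functional calculus of `λ₁`,
i.e. the `*`-homomorphism that maps the function `e^{it}` to `λ₁`. -/
def hat (α : ℝ) : C(S1, ℂ) →⋆ₐ[ℂ] CstarZ α :=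
  (continuousFunctionalCalculus (lam α) :
    C(spectrum ℂ (lam α), ℂ) →⋆ₐ[ℂ] CstarZ α).comp
    (ContinuousMap.compStarAlgHom' ℂ ℂ (spectrumToCircle α))

theorem hat_fourier_one (α : ℝ) : (hat α (fourier 1) : B) = lam α := by
  have h : (ContinuousMap.compStarAlgHom' ℂ ℂ (spectrumToCircle α)) (fourier 1) =
      (ContinuousMap.id ℂ).restrict (spectrum ℂ (lam α)) := by
    ext z
    change fourier 1 (spectrumToCircle α z) = (z : ℂ)
    rw [fourier_one]
    have h3 : ∀ t : S1, (AddCircle.toCircle t : Circle) = AddCircle.homeomorphCircle' t := by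
      intro t
      induction t using QuotientAddGroup.induction_on with
      | H x =>
        rw [AddCircle.homeomorphCircle'_apply_mk, AddCircle.toCircle_apply_mk]
        congr 1
        field_simp
    rw [h3]
    exact congrArg Subtype.val (AddCircle.homeomorphCircle'.apply_symm_apply _)
  have h2 := continuousFunctionalCalculus_map_id (lam α)
  rw [← h] at h2
  exact congrArg Subtype.val h2

/-- The operator of multiplication by the character `e^{inx}`. -/
def e (n : ℤ) : B := mulOp (fourier n)

theorem e_zero : e 0 = 1 := by
  ext1 v
  apply Lp.ext
  filter_upwards [mulOp_coeFn (fourier 0) v] with x hx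
  rw [e, hx]
  simp

/-- The elements of `𝔄`: the C*-algebras `𝒜` with `C*_r(ℤ) ⊆ 𝒜 ⊆ 𝒞`. -/
structure IntermediateAlgebra (α : ℝ) where
  alg : StarSubalgebra ℂ B
  isClosed : IsClosed (alg : Set B)
  le : CstarZ α ≤ alg
  ge : alg ≤ crossedProduct α

/-- The join `𝒜₁ ∨ 𝒜₂`, the closure of the algebra generated by `𝒜₁` and `𝒜₂`. -/
def IntermediateAlgebra.join {α : ℝ} (A₁ A₂ : IntermediateAlgebra α) : IntermediateAlgebra α where
  alg := (A₁.alg ⊔ A₂.alg).topologicalClosure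
  isClosed := StarSubalgebra.isClosed_topologicalClosure _
  le := A₁.le.trans (le_sup_left.trans (StarSubalgebra.le_topologicalClosure _))
  ge := StarSubalgebra.topologicalClosure_minimal (sup_le A₁.ge A₂.ge)
    (StarSubalgebra.isClosed_topologicalClosure _)

/-- The collection `𝓘` of closed ideals of the commutative algebra `C*_r(ℤ)`. -/
abbrev ClosedIdeal (α : ℝ) : Type :=
  {I : Ideal (CstarZ α) // IsClosed (I : Set (CstarZ α))}

/-- The ideal functions: maps `𝔠 : ℤ → 𝓘` with `𝔠(0) = C*_r(ℤ)`. -/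
structure IdealFunction (α : ℝ) where
  toFun : ℤ → ClosedIdeal α
  map_zero : (toFun 0).1 = ⊤

/-- The value `𝔠(n)` as an ideal of `C*_r(ℤ)`. -/
def IdealFunction.ideal {α : ℝ} (c : IdealFunction α) (n : ℤ) : Ideal (CstarZ α) := (c.toFun n).1

/-- `Supp(𝔠) = {n | 𝔠(n) ≠ (0)}`. -/
def IdealFunction.support {α : ℝ} (c : IdealFunction α) : Set ℤ := {n | c.ideal n ≠ ⊥}

/-- The set function of `𝔠`: the closed set of common zeros in `S¹` of the functions `φ`
with `φ̂ ∈ 𝔠(n)`. -/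
def IdealFunction.zeroSet {α : ℝ} (c : IdealFunction α) (n : ℤ) : Set S1 :=
  {t | ∀ φ : C(S1, ℂ), hat α φ ∈ c.ideal n → φ t = 0}

/-- The ideal function `Ψ(𝒜)(n) = {η ∈ C*_r(ℤ) | e^{inx} η ∈ 𝒜}`. -/
def IntermediateAlgebra.idealFunction {α : ℝ} (A : IntermediateAlgebra α) : IdealFunction α where
  toFun n :=
    ⟨{ carrier := {η | e n * (η : B) ∈ A.alg}
       add_mem' := by
         intro x y hx hy
         simpa [mul_add] using add_mem hx hy
       zero_mem' := by simp
       smul_mem' := by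
         intro c x hx
         have h : e n * (((c * x : CstarZ α)) : B) = (e n * (x : B)) * (c : B) := by
           rw [mul_comm c x, mul_assoc]; rfl
         change e n * (((c * x : CstarZ α)) : B) ∈ A.alg
         rw [h]
         exact mul_mem hx (A.le c.2) },
     A.isClosed.preimage (continuous_const.mul continuous_subtype_val)⟩
  map_zero := by
    ext η
    simpa [e_zero] using! A.le η.2

theorem mem_idealFunction {α : ℝ} (A : IntermediateAlgebra α) (n : ℤ) (η : CstarZ α) :
    η ∈ A.idealFunction.ideal n ↔ e n * (η : B) ∈ A.alg := Iff.rfl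

/-- `Φ(𝔠)`, the closed `*`-algebra generated by the elements `e^{inx} η`, `η ∈ 𝔠(n)`. -/
def IdealFunction.algebra {α : ℝ} (c : IdealFunction α) : IntermediateAlgebra α where
  alg := (StarAlgebra.adjoin ℂ
    {a : B | ∃ n : ℤ, ∃ η ∈ c.ideal n, a = e n * (η : B)}).topologicalClosure
  isClosed := StarSubalgebra.isClosed_topologicalClosure _
  le := by
    intro x hx
    refine StarSubalgebra.le_topologicalClosure _ (StarAlgebra.subset_adjoin _ _ ?_)
    refine ⟨0, ⟨x, hx⟩, ?_, ?_⟩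
    · rw [IdealFunction.ideal, c.map_zero]
      exact Submodule.mem_top
    · rw [e_zero, one_mul]
  ge := by
    refine StarSubalgebra.topologicalClosure_minimal (StarAlgebra.adjoin_le ?_)
      (StarSubalgebra.isClosed_topologicalClosure _)
    rintro a ⟨n, η, -, rfl⟩
    refine mul_mem ?_ (CstarZ_le_crossedProduct α η.2)
    exact StarSubalgebra.le_topologicalClosure _
      (StarAlgebra.subset_adjoin _ _ (mem_insert_of_mem _ (mem_range_self _)))

/-- `𝒜` is small if the support of its ideal function is finite. -/
def IntermediateAlgebra.IsSmall {α : ℝ} (A : IntermediateAlgebra α) : Prop :=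
  A.idealFunction.support.Finite

/-- `𝒜` is residual if it is not the trivial algebra `C*_r(ℤ)` and the closed set of `𝔠(n)` is
nowhere dense for every `n` in the support. -/
def IntermediateAlgebra.IsResidual {α : ℝ} (A : IntermediateAlgebra α) : Prop :=
  A.alg ≠ CstarZ α ∧
    ∀ n ∈ A.idealFunction.support, IsNowhereDense (A.idealFunction.zeroSet n)

/-- `τ^k P`, where `τ t = t + α`. -/
def rot (α : ℝ) (k : ℤ) (P : Set S1) : Set S1 := (fun t : S1 => t + k • (α : S1)) '' P

/-- The set function of the basic ideal function with data `(q, P)`. For `q = 0` it is `∅` at `0`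
and the whole circle elsewhere. -/
def basicSet (α : ℝ) (q : ℕ) (P : Set S1) (m : ℤ) : Set S1 :=
  if m = 0 then ∅
  else if (q : ℤ) ∣ m then
    if 0 < m then ⋃ j ∈ Ico (0 : ℤ) (m / q), rot α (-(j * q)) P
    else ⋃ j ∈ Icc (1 : ℤ) (-m / q), rot α (j * q) P
  else univ

/-- The closed ideal of `C*_r(ℤ)` associated with `P ⊆ S¹`: the (closure of the) set of all `φ̂`
with `φ` vanishing on `P`. -/
def idealOfZeros (α : ℝ) (P : Set S1) : ClosedIdeal α :=
  ⟨((ContinuousMap.idealOfSet ℂ Pᶜ).map (hat α)).closure, by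
    rw [Ideal.coe_closure]; exact isClosed_closure⟩

/-- The basic ideal function `𝔟_{q,P}`. -/
def basicIdealFunction (α : ℝ) (q : ℕ) (P : Set S1) : IdealFunction α where
  toFun m := idealOfZeros α (basicSet α q P m)
  map_zero := by
    rw [Ideal.eq_top_iff_one]
    refine subset_closure (a := (1 : CstarZ α)) ?_
    rw [← map_one (hat α)]
    refine Ideal.mem_map_of_mem _ ?_
    rw [ContinuousMap.mem_idealOfSet]
    simp [basicSet]

/-- The basic algebra `𝒜_{q,P}`. -/
def basicAlgebra (α : ℝ) (q : ℕ) (P : Set S1) : IntermediateAlgebra α :=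
  (basicIdealFunction α q P).algebra

/-- `𝒜` as a module over `C*_r(ℤ)` (acting by left multiplication). -/
def IntermediateAlgebra.toModule {α : ℝ} (A : IntermediateAlgebra α) :
    Submodule (CstarZ α) B where
  carrier := A.alg
  add_mem' := add_mem
  zero_mem' := zero_mem _
  smul_mem' η _ ha := mul_mem (A.le η.2) ha

/-- `𝒜` is finite dimensional as a (Banach) module over `C*_r(ℤ)`: it is topologically finitely
generated (a finite set spans a dense submodule), and it has finite rank (the cardinalities of
its `C*_r(ℤ)`-linearly independent subsets are bounded by a natural number). -/
def IntermediateAlgebra.IsFiniteDimensional {α : ℝ} (A : IntermediateAlgebra α) : Prop :=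
  (∃ s : Finset B, (Submodule.span (CstarZ α) (s : Set B)).topologicalClosure = A.toModule) ∧
    Module.rank (CstarZ α) A.toModule < Cardinal.aleph0

end RotationAlgebra

end

noncomputable section

namespace RotationAlgebra

/-! ### Monomials and the functional calculus on the Fourier basis -/

open Filter Topology

/-! In the Fourier basis of L², e^{inx} shifts indices by n and φ̂ is diagonal with eigenvalues
φ(kα). Since α is irrational, the points kα are dense, so `op` is isometric with range C*_r(ℤ);
moving φ̂ past e^{inx} translates φ by nα. Averaging λ₁ᵏ a λ₁⁻ᵏ against e^{-iknα} extracts the n-th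
Fourier component of a without leaving the intermediate algebra (`exists_component`).

Write Z(n) for the closed set 𝔠̌(n). Then e^{inx} φ̂ lies in 𝒜 exactly when φ vanishes on Z(n)
(`monomial_mem_iff`), and n is in the support exactly when Z(n) ≠ S¹. Closure under products and
adjoints gives the cocycle relations Z(n+m) ⊆ τ^{-m}Z(n) ∪ Z(m) and Z(-n) ⊆ τⁿZ(n). Conversely, a
cocycle of closed sets is the set function of the algebra its monomials generate (`zeroSet_eq`),
which computes the set functions of basic algebras.

The proposition is now about closed sets. If Z(n) has empty interior, so has every Z(kn), a subset
of a finite union of its translates; hence all kn lie in the support and 𝒜 is not small. If P has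
interior, minimality and compactness make finitely many translates of P cover the circle, so 𝒜_{q,P}
is small. Elements of small algebras are finite sums of monomials, whence the module statements.
When P ∪ τP = S¹ only the degrees -1, 0, 1 occur, and a function ψ with ψ(t+α) = ψ(t) off P gives a
central ψ̂. For the join, a partition of unity recovers e^{ix} from two small algebras. -/

theorem mulOp_eq_ae {f : C(X, ℂ)} {v w : H}
    (h : (w : X → ℂ) =ᵐ[AddCircle.haarAddCircle] fun x => f x * v x) : mulOp f v = w :=
  Lp.ext ((mulOp_coeFn f v).trans h.symm)

theorem e_fourierLp (n k : ℤ) : e n (fourierLp 2 k) = (fourierLp 2 (n + k) : H) := by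
  apply mulOp_eq_ae
  filter_upwards [coeFn_fourierLp (T := 2 * π) 2 k, coeFn_fourierLp (T := 2 * π) 2 (n + k)]
    with x h1 h2
  rw [h1, h2, fourier_add]

theorem fourier_apply_add (k : ℤ) (x y : X) : fourier k (x + y) = fourier k x * fourier k y := by
  simp only [fourier_apply, smul_add, AddCircle.toCircle_add, Circle.coe_mul]

theorem fourier_apply_zsmul (k n : ℤ) (x : X) : fourier k (n • x) = fourier n (k • x) := by
  simp only [fourier_apply, smul_smul, mul_comm]

theorem fourier_mul_apply (k n : ℤ) (x : X) : fourier (k * n) x = fourier k x ^ n := by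
  simp only [fourier_apply, ← smul_smul, mul_comm k n, AddCircle.toCircle_zsmul, Circle.coe_zpow]

theorem lam_fourierLp (α : ℝ) (k : ℤ) :
    lam α (fourierLp 2 k) = fourier k (α : X) • (fourierLp 2 k : H) := by
  apply Lp.ext
  have h0 := coeFn_fourierLp (T := 2 * π) 2 k
  filter_upwards [lam_coeFn α (fourierLp 2 k), h0,
    Lp.coeFn_smul (fourier k (α : X)) (fourierLp 2 k : H),
    (measurePreserving_rotation (α : X)).quasiMeasurePreserving.ae_eq_comp h0] with x h1 h2 h3 h4
  rw [h1, h3, Pi.smul_apply, h2, _root_.smul_eq_mul]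
  simp only [Function.comp_apply] at h4
  rw [h4, fourier_apply_add, mul_comm]

/-- Operators on `L²` are determined by their values on the Fourier monomials. -/
theorem ext_fourierLp {a b : B} (h : ∀ k : ℤ, a (fourierLp 2 k) = b (fourierLp 2 k)) : a = b := by
  refine ContinuousLinearMap.ext_on (s := range (fourierLp (T := 2 * π) 2)) ?_ ?_
  · exact Submodule.dense_iff_topologicalClosure_eq_top.mpr
      (span_fourierLp_closure_eq_top (by simp))
  · rintro _ ⟨k, rfl⟩
    exact h k

/-- Vectors in `L²` are determined by their Fourier coefficients. -/
theorem vector_ext_fourierLp {v w : H}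
    (h : ∀ k : ℤ, inner ℂ (fourierLp 2 k : H) v = inner ℂ (fourierLp 2 k : H) w) : v = w := by
  apply (fourierBasis (T := 2 * π)).repr.injective
  ext k
  simpa [HilbertBasis.repr_apply_apply] using h k

theorem inner_fourierLp (j k : ℤ) :
    inner ℂ (fourierLp 2 j : H) (fourierLp 2 k) = if j = k then (1 : ℂ) else 0 :=
  orthonormal_iff_ite.mp orthonormal_fourier j k

theorem fourierLp_ne_zero (k : ℤ) : (fourierLp 2 k : H) ≠ 0 :=
  orthonormal_fourier.ne_zero k

theorem e_add (n m : ℤ) : e (n + m) = e n * e m :=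
  ext_fourierLp fun k => by
    simp only [mul_apply_eq_comp, e_fourierLp, add_assoc]

theorem e_neg_mul (n : ℤ) : e (-n) * e n = 1 := by rw [← e_add, neg_add_cancel, e_zero]

theorem star_e (n : ℤ) : star (e n) = e (-n) := by
  refine ext_fourierLp fun k => vector_ext_fourierLp fun j => ?_
  rw [ContinuousLinearMap.star_eq_adjoint, ContinuousLinearMap.adjoint_inner_right, e_fourierLp,
    e_fourierLp, inner_fourierLp, inner_fourierLp]
  congr 1
  exact propext (by constructor <;> intro h <;> omega)

theorem norm_e_le (n : ℤ) : ‖e n‖ ≤ 1 := by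
  have h : ‖e n‖ * ‖e n‖ = ‖(1 : B)‖ := by
    rw [← CStarRing.norm_star_mul_self, star_e, e_neg_mul]
  have h1 : ‖(1 : B)‖ ≤ 1 := ContinuousLinearMap.norm_id_le
  nlinarith [norm_nonneg (e n)]

theorem e_natCast (n : ℕ) : e n = e 1 ^ n := by
  induction n with
  | zero => simp [e_zero]
  | succ n ih => rw [Nat.cast_succ, e_add, ih, pow_succ]

/-- The multiples of `α` form a dense subset of the circle. -/
theorem denseRange_zsmul {α : ℝ} (hα : Irrational (α / (2 * π))) :
    DenseRange fun k : ℤ => k • (α : S1) := by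
  have h := (AddCircle.denseRange_zsmul_coe_iff (p := 2 * π) (a := α)).mpr hα
  exact h

/-- The functional calculus `φ ↦ φ̂` with values in the bounded operators. -/
def op (α : ℝ) : C(S1, ℂ) →⋆ₐ[ℂ] B := (CstarZ α).subtype.comp (hat α)

theorem coe_hat (α : ℝ) (φ : C(S1, ℂ)) : (hat α φ : B) = op α φ := rfl

theorem op_mem_CstarZ (α : ℝ) (φ : C(S1, ℂ)) : op α φ ∈ CstarZ α := (hat α φ).2

theorem op_fourier_one (α : ℝ) : op α (fourier 1) = lam α := hat_fourier_one α

theorem continuous_op (α : ℝ) : Continuous (op α) :=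
  AddMonoidHomClass.continuous_of_bound (op α) 1 fun φ => by
    rw [one_mul]; exact NonUnitalStarAlgHom.norm_apply_le (op α) φ

theorem fourier_one_pow (n : ℕ) : (fourier (n : ℤ) : C(S1, ℂ)) = fourier 1 ^ n := by
  ext x
  rw [ContinuousMap.pow_apply, ← zpow_natCast, ← fourier_mul_apply, one_mul]

theorem op_fourier_apply (α : ℝ) (n k : ℤ) :
    op α (fourier n) (fourierLp 2 k) = fourier n (k • (α : S1)) • (fourierLp 2 k : H) := by
  have key : ∀ n : ℕ, op α (fourier (n : ℤ)) (fourierLp 2 k) =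
      fourier (n : ℤ) (k • (α : S1)) • (fourierLp 2 k : H) := by
    intro n
    rw [fourier_one_pow, map_pow, op_fourier_one]
    induction n with
    | zero => simp
    | succ n ih =>
      rw [pow_succ', mul_apply_eq_comp, ih, map_smul, lam_fourierLp, smul_smul,
        ContinuousMap.pow_apply, ContinuousMap.pow_apply, pow_succ, ← fourier_apply_zsmul,
        one_smul]
  obtain ⟨m, rfl | rfl⟩ := n.eq_nat_or_neg
  · exact key m
  · have h1 : (fourier (-(m : ℤ)) : C(S1, ℂ)) * fourier (m : ℤ) = 1 := by
      ext x
      rw [ContinuousMap.mul_apply, ← fourier_add]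
      simp
    have h2 : op α (fourier (-(m : ℤ))) * op α (fourier (m : ℤ)) = 1 := by
      rw [← map_mul, h1, map_one]
    have h4 : fourier (-(m : ℤ)) (k • (α : S1)) * fourier (m : ℤ) (k • (α : S1)) = (1 : ℂ) := by
      rw [← fourier_add]; simp
    have h3 : op α (fourier (-(m : ℤ))) (op α (fourier (m : ℤ)) (fourierLp 2 k)) =
        (fourierLp 2 k : H) := by
      rw [← mul_apply_eq_comp, h2]; rfl
    rw [key, map_smul] at h3
    rw [← h3, smul_smul, h4, one_smul, h3]

/-- `φ̂` is the diagonal operator with eigenvalues `φ(kα)`. -/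
theorem op_apply (α : ℝ) (φ : C(S1, ℂ)) (k : ℤ) :
    op α φ (fourierLp 2 k) = φ (k • (α : S1)) • (fourierLp 2 k : H) := by
  have hd : Dense (Submodule.span ℂ (range (fourier (T := 2 * π))) : Set C(S1, ℂ)) :=
    Submodule.dense_iff_topologicalClosure_eq_top.mpr span_fourier_closure_eq_top
  have hc : Continuous fun φ : C(S1, ℂ) => φ (k • (α : S1)) • (fourierLp 2 k : H) :=
    Continuous.smul (f := fun φ : C(S1, ℂ) => φ (k • (α : S1)))
      (continuous_eval_const _) continuous_const
  refine congrFun (Continuous.ext_on hd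
    ((ContinuousLinearMap.apply ℂ H (fourierLp 2 k : H)).continuous.comp (continuous_op α)) hc ?_) φ
  intro ψ hψ
  induction hψ using Submodule.span_induction with
  | mem x h => obtain ⟨n, rfl⟩ := h; exact op_fourier_apply α n k
  | zero => simp
  | add x y _ _ hx hy =>
    simp only [Function.comp_apply, ContinuousLinearMap.apply_apply, map_add,
      ContinuousMap.add_apply, add_smul] at hx hy ⊢
    rw [hx, hy]
  | smul c x _ hx =>
    simp only [Function.comp_apply, ContinuousLinearMap.apply_apply, map_smul,
      ContinuousMap.smul_apply, smul_assoc] at hx ⊢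
    rw [← hx]

/-- The translate `t ↦ φ (t + s)`. -/
def shift (s : S1) (φ : C(S1, ℂ)) : C(S1, ℂ) := φ.comp ⟨fun t => t + s, by fun_prop⟩

@[simp] theorem shift_apply (s t : S1) (φ : C(S1, ℂ)) : shift s φ t = φ (t + s) := rfl

theorem op_mul_e (α : ℝ) (φ : C(S1, ℂ)) (n : ℤ) :
    op α φ * e n = e n * op α (shift (n • (α : S1)) φ) :=
  ext_fourierLp fun k => by
    simp only [mul_apply_eq_comp, op_apply, e_fourierLp, map_smul, shift_apply,
      add_smul, add_comm]

theorem e_mul_op (α : ℝ) (φ : C(S1, ℂ)) (n : ℤ) :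
    e n * op α φ = op α (shift (-(n • (α : S1))) φ) * e n := by
  rw [op_mul_e]
  congr 3
  ext t
  simp

/-- This rule and `star_monomial` are the source of the translations in `IsCocycle`. -/
theorem monomial_mul (α : ℝ) (φ ψ : C(S1, ℂ)) (n m : ℤ) :
    (e n * op α φ) * (e m * op α ψ) =
      e (n + m) * op α (shift (m • (α : S1)) φ * ψ) := by
  rw [map_mul, e_add, mul_assoc, ← mul_assoc (op α φ), op_mul_e]
  simp only [mul_assoc]

theorem star_monomial (α : ℝ) (φ : C(S1, ℂ)) (n : ℤ) :
    star (e n * op α φ) =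
      e (-n) * op α (shift ((-n) • (α : S1)) (star φ)) := by
  rw [star_mul, star_e, ← map_star, op_mul_e]

/-! ### Irrational rotation: the functional calculus is an isometric isomorphism -/

section Irrational

variable {α : ℝ} (hα : Irrational (α / (2 * π)))
include hα

theorem eq_of_apply_zsmul {φ ψ : C(S1, ℂ)} (h : ∀ k : ℤ, φ (k • (α : S1)) = ψ (k • (α : S1))) :
    φ = ψ :=
  DFunLike.coe_injective <| (denseRange_zsmul hα).equalizer φ.continuous ψ.continuous (funext h)

theorem op_injective : Function.Injective (op α) := by
  intro φ ψ h
  refine eq_of_apply_zsmul hα fun k => ?_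
  have := congrArg (fun a : B => a (fourierLp 2 k)) h
  simp only [op_apply] at this
  exact smul_left_injective ℂ (fourierLp_ne_zero k) this

theorem op_isometry : Isometry (op α) :=
  NonUnitalStarAlgHom.isometry (op α) (op_injective hα)

/-- The range of an isometry from a complete space is closed, and it contains the generator λ₁. -/
theorem exists_op_eq {a : B} (ha : a ∈ CstarZ α) : ∃ φ, op α φ = a := by
  have hcl : IsClosed ((op α).range : Set B) := by
    change IsClosed (range (op α))
    exact (op_isometry hα).isClosedEmbedding.isClosed_range
  have hle : CstarZ α ≤ (op α).range :=
    StarAlgebra.elemental.le_of_mem hcl ⟨fourier 1, op_fourier_one α⟩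
  exact hle ha

theorem hat_surjective : Function.Surjective (hat α) := fun η => by
  obtain ⟨φ, h⟩ := exists_op_eq hα η.2
  exact ⟨φ, Subtype.ext h⟩

theorem hat_injective : Function.Injective (hat α) := fun _ _ h =>
  op_injective hα (congrArg Subtype.val h)

theorem hat_isometry : Isometry (hat α) :=
  NonUnitalStarAlgHom.isometry (hat α) (hat_injective hα)

end Irrational

/-! ### Fourier components as limits of averages -/

/-- The set of points at which a pointwise bounded sequence of linear maps converges to an element
of a given closed set is closed. -/
theorem isClosed_setOf_exists_tendsto {E : Type*} [NormedAddCommGroup E] [Module ℂ E]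
    [CompleteSpace E] (T : ℕ → E →ₗ[ℂ] E) (hT : ∀ N a, ‖T N a‖ ≤ ‖a‖) {R : Set E}
    (hR : IsClosed R) : IsClosed {a | ∃ r ∈ R, Tendsto (fun N => T N a) atTop (𝓝 r)} := by
  have hd : ∀ N a b, dist (T N a) (T N b) ≤ dist a b := fun N a b => by
    rw [dist_eq_norm, dist_eq_norm, ← map_sub]; exact hT N _
  refine isClosed_of_closure_subset fun a ha => ?_
  rw [Metric.mem_closure_iff] at ha
  have hcauchy : CauchySeq fun N => T N a := by
    refine Metric.cauchySeq_iff'.mpr fun ε hε => ?_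
    -- The maps are contractions, so the sequence at `a` stays within ε/3 of the convergent sequence
    -- at a nearby `b`.
    obtain ⟨b, ⟨r, -, hr⟩, hab⟩ := ha (ε / 3) (by positivity)
    obtain ⟨N, hN⟩ := Metric.cauchySeq_iff'.mp hr.cauchySeq (ε / 3) (by positivity)
    refine ⟨N, fun n hn => ?_⟩
    have h1 := hd n a b
    have h2 := hd N b a
    rw [dist_comm b a] at h2
    have h3 := dist_triangle4 (T n a) (T n b) (T N b) (T N a)
    have h4 := hN n hn
    linarith
  obtain ⟨r, hr⟩ := cauchySeq_tendsto_of_complete hcauchy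
  refine ⟨r, ?_, hr⟩
  rw [← hR.closure_eq, Metric.mem_closure_iff]
  intro ε hε
  obtain ⟨b, ⟨s, hs, hsb⟩, hab⟩ := ha ε hε
  exact ⟨s, hs, (le_of_tendsto (hr.dist hsb) (Eventually.of_forall fun N => hd N a b)).trans_lt hab⟩

/-- Averages of the powers of a nontrivial unimodular number tend to zero. -/
theorem tendsto_average_pow {w : ℂ} (hw : ‖w‖ = 1) (hw1 : w ≠ 1) :
    Tendsto (fun N : ℕ => (N : ℂ)⁻¹ * ∑ k ∈ Finset.range N, w ^ k) atTop (𝓝 0) := by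
  have hb : ∀ N : ℕ, ‖∑ k ∈ Finset.range N, w ^ k‖ ≤ 2 / ‖w - 1‖ := fun N => by
    rw [geom_sum_eq hw1, norm_div]
    gcongr
    calc ‖w ^ N - 1‖ ≤ ‖w ^ N‖ + ‖(1 : ℂ)‖ := norm_sub_le _ _
      _ = 2 := by rw [norm_pow, hw]; norm_num
  have h0 : Tendsto (fun N : ℕ => (N : ℝ)⁻¹ * (2 / ‖w - 1‖)) atTop (𝓝 0) := by
    simpa using (tendsto_inv_atTop_nhds_zero_nat (𝕜 := ℝ)).mul_const (2 / ‖w - 1‖)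
  refine squeeze_zero_norm (fun N => ?_) h0
  rw [norm_mul, norm_inv, Complex.norm_natCast]
  gcongr
  exact hb N

/-- The averages `N⁻¹ ∑_{k < N} e^{-iknα} λ₁ᵏ a λ₁⁻ᵏ`, which converge to the `n`-th Fourier
component of `a`. -/
def avg (α : ℝ) (n : ℤ) (N : ℕ) : B →ₗ[ℂ] B :=
  (N : ℂ)⁻¹ • ∑ k ∈ Finset.range N, (fourier (-(k : ℤ)) (n • (α : S1)) : ℂ) •
    (LinearMap.mulLeft ℂ (op α (fourier (k : ℤ)))).comp
      (LinearMap.mulRight ℂ (op α (fourier (-(k : ℤ)))))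

theorem avg_apply (α : ℝ) (n : ℤ) (N : ℕ) (a : B) :
    avg α n N a = (N : ℂ)⁻¹ • ∑ k ∈ Finset.range N, (fourier (-(k : ℤ)) (n • (α : S1)) : ℂ) •
      (op α (fourier (k : ℤ)) * (a * op α (fourier (-(k : ℤ))))) := by
  simp [avg, LinearMap.sum_apply]

theorem norm_fourier_apply (n : ℤ) (x : S1) : ‖(fourier n x : ℂ)‖ = 1 := by
  rw [fourier_apply]; exact Circle.norm_coe _

theorem norm_op_fourier_le (α : ℝ) (n : ℤ) : ‖op α (fourier n)‖ ≤ 1 :=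
  (NonUnitalStarAlgHom.norm_apply_le (op α) _).trans (fourier_norm n).le

theorem norm_avg_le (α : ℝ) (n : ℤ) (N : ℕ) (a : B) : ‖avg α n N a‖ ≤ ‖a‖ := by
  rw [avg_apply, norm_smul, norm_inv, Complex.norm_natCast]
  have h : ‖∑ k ∈ Finset.range N, (fourier (-(k : ℤ)) (n • (α : S1)) : ℂ) •
      (op α (fourier (k : ℤ)) * (a * op α (fourier (-(k : ℤ)))))‖ ≤ N * ‖a‖ := by
    refine (norm_sum_le_of_le (n := fun _ => ‖a‖) _ fun k _ => ?_).trans (by simp)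
    rw [norm_smul, norm_fourier_apply, one_mul]
    calc _ ≤ ‖op α (fourier (k : ℤ))‖ * (‖a‖ * ‖op α (fourier (-(k : ℤ)))‖) :=
          (norm_mul_le _ _).trans (by gcongr; exact norm_mul_le _ _)
      _ ≤ 1 * (‖a‖ * 1) := by gcongr <;> exact norm_op_fourier_le _ _
      _ = ‖a‖ := by ring
  rcases N.eq_zero_or_pos with rfl | hN
  · simp
  · have : (0 : ℝ) < N := by exact_mod_cast hN
    calc (N : ℝ)⁻¹ * _ ≤ (N : ℝ)⁻¹ * (N * ‖a‖) := by gcongr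
      _ = ‖a‖ := by field_simp

theorem op_mul_op_comm (α : ℝ) (φ ψ : C(S1, ℂ)) : op α φ * op α ψ = op α ψ * op α φ := by
  rw [← map_mul, mul_comm φ, map_mul]

theorem op_fourier_mul_e (α : ℝ) (k m : ℤ) :
    op α (fourier k) * e m = (fourier k (m • (α : S1)) : ℂ) • (e m * op α (fourier k)) := by
  rw [op_mul_e, ← mul_smul_comm, ← map_smul]
  congr 2
  ext t
  rw [shift_apply, fourier_apply_add, mul_comm]
  rfl

theorem op_fourier_mul_neg (α : ℝ) (k : ℤ) : op α (fourier k) * op α (fourier (-k)) = 1 := by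
  rw [← map_mul, ← map_one (op α)]
  congr 1
  ext t
  rw [ContinuousMap.mul_apply, ← fourier_add]
  simp

/-- Conjugation by λ₁ᵏ multiplies a monomial of degree m by e^{ikmα}, so averaging against e^{-iknα}
leaves a geometric mean with ratio e^{i(m-n)α}. By irrationality the ratio is 1 only for m = n. -/
theorem avg_monomial (α : ℝ) (n m : ℤ) (φ : C(S1, ℂ)) (N : ℕ) :
    avg α n N (e m * op α φ) = ((N : ℂ)⁻¹ * ∑ k ∈ Finset.range N,
      (fourier 1 ((m - n) • (α : S1)) : ℂ) ^ k) • (e m * op α φ) := by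
  rw [avg_apply, mul_smul, Finset.sum_smul]
  congr 1
  refine Finset.sum_congr rfl fun k _ => ?_
  have h1 : op α (fourier (k : ℤ)) * (e m * op α φ * op α (fourier (-(k : ℤ)))) =
      (fourier (k : ℤ) (m • (α : S1)) : ℂ) • (e m * op α φ) := by
    rw [← mul_assoc, ← mul_assoc, op_fourier_mul_e, smul_mul_assoc, smul_mul_assoc,
      mul_assoc (e m), op_mul_op_comm, mul_assoc, mul_assoc, op_fourier_mul_neg, mul_one]
  rw [h1, smul_smul]
  congr 1
  rw [← zpow_natCast, ← fourier_mul_apply, one_mul, sub_smul, sub_eq_add_neg, fourier_apply_add,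
    ← neg_smul, fourier_apply_zsmul k (-n), fourier_apply_zsmul (-k) n, mul_comm]
  congr 1
  rw [fourier_apply, fourier_apply]
  simp

/-- Averaging preserves the matrix coefficients on the `n`-th diagonal. -/
theorem inner_avg (α : ℝ) (n : ℤ) {N : ℕ} (hN : N ≠ 0) (a : B) (k : ℤ) :
    inner ℂ (fourierLp 2 (n + k) : H) (avg α n N a (fourierLp 2 k)) =
      inner ℂ (fourierLp 2 (n + k) : H) (a (fourierLp 2 k)) := by
  have h : ∀ j : ℤ, inner ℂ (fourierLp 2 (n + k) : H)
      ((fourier (-j) (n • (α : S1)) : ℂ) • (op α (fourier j) * (a * op α (fourier (-j))))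
        (fourierLp 2 k)) = inner ℂ (fourierLp 2 (n + k) : H) (a (fourierLp 2 k)) := by
    intro j
    -- Both basis vectors are eigenvectors of the powers of λ₁; on the n-th diagonal the resulting
    -- phases cancel the weight e^{-ijnα}.
    have h1 : op α (fourier j) = star (op α (fourier (-j))) := by
      rw [← map_star]
      congr 1
      ext t
      simp
    rw [mul_apply_eq_comp, mul_apply_eq_comp, op_apply, h1,
      ContinuousLinearMap.map_smul, inner_smul_right, ContinuousLinearMap.map_smul, inner_smul_right,
      ContinuousLinearMap.star_eq_adjoint,
      ContinuousLinearMap.adjoint_inner_right, op_apply, inner_smul_left, ← fourier_neg, neg_neg,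
      ← mul_assoc, ← mul_assoc, add_smul, fourier_apply_add]
    have h2 : ∀ x : S1, (fourier (-j) x : ℂ) * fourier j x = 1 := fun x => by
      rw [← fourier_add]; simp
    calc _ = (fourier (-j) (n • (α : S1)) * fourier j (n • (α : S1)) : ℂ) *
        (fourier (-j) (k • (α : S1)) * fourier j (k • (α : S1)) : ℂ) *
        inner ℂ (fourierLp 2 (n + k) : H) (a (fourierLp 2 k)) := by ring
      _ = _ := by rw [h2, h2]; ring
  rw [avg_apply, smul_apply, inner_smul_right, sum_apply,
    inner_sum]
  simp only [smul_apply, h, Finset.sum_const, Finset.card_range, nsmul_eq_mul]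
  have : (N : ℂ) ≠ 0 := by exact_mod_cast hN
  field_simp

/-- An operator is determined by its Fourier components. -/
theorem eq_of_tendsto_avg {α : ℝ} {a b : B} (c : ℤ → B)
    (ha : ∀ n, Tendsto (fun N => avg α n N a) atTop (𝓝 (c n)))
    (hb : ∀ n, Tendsto (fun N => avg α n N b) atTop (𝓝 (c n))) : a = b := by
  have key : ∀ {a : B}, (∀ n, Tendsto (fun N => avg α n N a) atTop (𝓝 (c n))) → ∀ n k : ℤ,
      inner ℂ (fourierLp 2 (n + k) : H) (a (fourierLp 2 k)) =
        inner ℂ (fourierLp 2 (n + k) : H) (c n (fourierLp 2 k)) := by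
    intro a ha n k
    have h1 : Continuous fun x : B => inner ℂ (fourierLp 2 (n + k) : H) (x (fourierLp 2 k)) := by
      fun_prop
    refine tendsto_nhds_unique ?_ ((h1.tendsto _).comp (ha n))
    refine tendsto_const_nhds.congr' ?_
    filter_upwards [eventually_ne_atTop 0] with N hN
    exact (inner_avg α n hN a k).symm
  refine ext_fourierLp fun k => vector_ext_fourierLp fun j => ?_
  obtain ⟨n, rfl⟩ : ∃ n, j = n + k := ⟨j - k, by ring⟩
  rw [key ha, key hb]

section Irrational

variable {α : ℝ} (hα : Irrational (α / (2 * π)))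
include hα

theorem zsmul_eq_zero_iff {n : ℤ} : n • (α : S1) = 0 ↔ n = 0 := by
  have h := AddCircle.denseRange_zsmul_iff.mp (denseRange_zsmul hα)
  rw [← addOrderOf_dvd_iff_zsmul_eq_zero, h]
  simp

theorem fourier_one_zsmul_ne_one {n : ℤ} (hn : n ≠ 0) : (fourier 1 (n • (α : S1)) : ℂ) ≠ 1 := by
  rw [fourier_one, ne_eq, Circle.coe_eq_one]
  intro h
  refine hn ((zsmul_eq_zero_iff hα).mp ?_)
  exact AddCircle.injective_toCircle Real.two_pi_pos.ne' (h.trans AddCircle.toCircle_zero.symm)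

theorem tendsto_avg_monomial (n m : ℤ) (φ : C(S1, ℂ)) :
    Tendsto (fun N => avg α n N (e m * op α φ)) atTop
      (𝓝 (if m = n then e m * op α φ else 0)) := by
  simp only [avg_monomial]
  split_ifs with h
  · subst h
    refine tendsto_const_nhds.congr' ?_
    filter_upwards [eventually_ne_atTop 0] with N hN
    have : (N : ℂ) ≠ 0 := by exact_mod_cast hN
    simp [this]
  · rw [← zero_smul ℂ (e m * op α φ)]
    refine (tendsto_average_pow (norm_fourier_apply _ _) ?_).smul_const _
    exact fourier_one_zsmul_ne_one hα (sub_ne_zero.mpr h)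

end Irrational

/-! ### Cocycles of sets and the algebras of their monomials -/

/-- Families of subsets of the circle which are the set functions of algebras of monomials. -/
structure IsCocycle (α : ℝ) (S : ℤ → Set S1) : Prop where
  zero : S 0 = ∅
  neg : ∀ n t, t ∈ S (-n) → t + (-n) • (α : S1) ∈ S n
  add : ∀ n m t, t ∈ S (n + m) → t + m • (α : S1) ∈ S n ∨ t ∈ S m

/-- The monomials `e^{inx} φ̂` with `φ` vanishing on `S n`. -/
def monomials (α : ℝ) (S : ℤ → Set S1) : Set B :=
  {a | ∃ n φ, (∀ t ∈ S n, φ t = 0) ∧ a = e n * op α φ}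

/-- The `*`-algebra of polynomials `∑ e^{inx} φ̂ₙ` with `φₙ` vanishing on `S n`. -/
def cocycleAlgebra {α : ℝ} {S : ℤ → Set S1} (hS : IsCocycle α S) : StarSubalgebra ℂ B where
  toSubalgebra := (Submodule.span ℂ (monomials α S)).toSubalgebra
    (Submodule.subset_span ⟨0, 1, by simp [hS.zero], by rw [e_zero, map_one, mul_one]⟩) (by
      intro a b ha hb
      have h := Submodule.mul_mem_mul ha hb
      rw [Submodule.span_mul_span] at h
      refine Submodule.span_mono ?_ h
      rintro _ ⟨_, ⟨n, φ, hφ, rfl⟩, _, ⟨m, ψ, hψ, rfl⟩, rfl⟩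
      refine ⟨n + m, _, fun t ht => ?_, monomial_mul α φ ψ n m⟩
      rw [ContinuousMap.mul_apply, shift_apply]
      rcases hS.add n m t ht with h | h
      · rw [hφ _ h, zero_mul]
      · rw [hψ _ h, mul_zero])
  star_mem' := by
    intro a ha
    change a ∈ Submodule.span ℂ (monomials α S) at ha
    change star a ∈ Submodule.span ℂ (monomials α S)
    induction ha using Submodule.span_induction with
    | mem x hx =>
      obtain ⟨n, φ, hφ, rfl⟩ := hx
      refine Submodule.subset_span ⟨-n, _, fun t ht => ?_, star_monomial α φ n⟩
      rw [shift_apply, ContinuousMap.star_apply, hφ _ (hS.neg n t ht), star_zero]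
    | zero => simp
    | add x y _ _ hx hy => rw [star_add]; exact add_mem hx hy
    | smul c x _ hx => rw [star_smul]; exact Submodule.smul_mem _ _ hx

theorem monomial_mem_cocycleAlgebra {α : ℝ} {S : ℤ → Set S1} (hS : IsCocycle α S) {n : ℤ}
    {φ : C(S1, ℂ)} (hφ : ∀ t ∈ S n, φ t = 0) : e n * op α φ ∈ cocycleAlgebra hS :=
  Submodule.subset_span ⟨n, φ, hφ, rfl⟩

theorem isCocycle_empty (α : ℝ) : IsCocycle α fun _ => ∅ :=
  ⟨rfl, by simp, by simp⟩

theorem mulOp_mem_closure_cocycleAlgebra (α : ℝ) (f : C(X, ℂ)) :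
    mulOp f ∈ (cocycleAlgebra (isCocycle_empty α)).topologicalClosure := by
  have hd : Dense (Submodule.span ℂ (range (fourier (T := 2 * π))) : Set C(X, ℂ)) :=
    Submodule.dense_iff_topologicalClosure_eq_top.mpr span_fourier_closure_eq_top
  let L : C(X, ℂ) →L[ℂ] B := ((ContinuousLinearMap.mul ℂ ℂ).holderL AddCircle.haarAddCircle ∞ 2 2
    : Lp ℂ ∞ (AddCircle.haarAddCircle : Measure X) →L[ℂ] B) ∘L
    (ContinuousMap.toLp ∞ AddCircle.haarAddCircle ℂ : C(X, ℂ) →L[ℂ] _)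
  have hL : ∀ f, mulOp f = L f := fun f => rfl
  have hmaps : MapsTo L (Submodule.span ℂ (range (fourier (T := 2 * π))))
      (cocycleAlgebra (isCocycle_empty α) : Set B) := by
    intro g hg
    induction hg using Submodule.span_induction with
    | mem x hx =>
      obtain ⟨n, rfl⟩ := hx
      have := monomial_mem_cocycleAlgebra (isCocycle_empty α) (n := n) (φ := 1) (by simp)
      rwa [map_one, mul_one] at this
    | zero => simp
    | add x y _ _ hx hy => rw [map_add]; exact add_mem hx hy
    | smul c x _ hx => rw [map_smul]; exact SMulMemClass.smul_mem c hx
  have := hmaps.closure L.continuous (hd f)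
  exact this

/-- For the empty cocycle the monomials are unrestricted. Every element of the crossed product is
thus a limit of polynomials, so its averages converge. -/
theorem crossedProduct_le (α : ℝ) :
    crossedProduct α ≤ (cocycleAlgebra (isCocycle_empty α)).topologicalClosure := by
  refine StarSubalgebra.topologicalClosure_minimal (StarAlgebra.adjoin_le ?_)
    (StarSubalgebra.isClosed_topologicalClosure _)
  refine insert_subset ?_ (range_subset_iff.mpr (mulOp_mem_closure_cocycleAlgebra α))
  refine StarSubalgebra.le_topologicalClosure _ ?_
  have := monomial_mem_cocycleAlgebra (isCocycle_empty α) (n := 0) (φ := fourier 1) (by simp)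
  rwa [e_zero, one_mul, op_fourier_one] at this

theorem e_mul_injective (n : ℤ) : Function.Injective (e n * · : B → B) := fun a b h => by
  have := congrArg (e (-n) * ·) h
  simpa only [← mul_assoc, e_neg_mul, one_mul] using this

theorem isometry_e_mul (n : ℤ) : Isometry (e n * · : B → B) := by
  refine Isometry.of_dist_eq fun a b => ?_
  rw [dist_eq_norm, dist_eq_norm, ← mul_sub]
  have h : ∀ (m : ℤ) (c : B), ‖e m * c‖ ≤ ‖c‖ := fun m c =>
    (norm_mul_le _ _).trans (mul_le_of_le_one_left (norm_nonneg _) (norm_e_le m))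
  refine le_antisymm (h _ _) ?_
  calc ‖a - b‖ = ‖e (-n) * (e n * (a - b))‖ := by rw [← mul_assoc, e_neg_mul, one_mul]
    _ ≤ _ := h _ _

theorem isClosed_vanishing (Z : Set S1) : IsClosed {φ : C(S1, ℂ) | ∀ t ∈ Z, φ t = 0} := by
  simp only [ofPred_forall]
  exact isClosed_iInter fun t => isClosed_iInter fun _ =>
    isClosed_eq (continuous_eval_const t) continuous_const

/-- The Fourier components of the elements of the closure of an algebra of polynomials. -/
theorem exists_tendsto_avg {α : ℝ} (hα : Irrational (α / (2 * π))) {S : ℤ → Set S1}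
    (hS : IsCocycle α S) {a : B} (ha : a ∈ (cocycleAlgebra hS).topologicalClosure) (n : ℤ) :
    ∃ φ : C(S1, ℂ), (∀ t ∈ S n, φ t = 0) ∧
      Tendsto (fun N => avg α n N a) atTop (𝓝 (e n * op α φ)) := by
  -- The admissible components form a closed set, being an isometric image of a closed ideal;
  -- convergence therefore passes from polynomials to their closure.
  have hR : IsClosed ((fun φ => e n * op α φ) '' {φ : C(S1, ℂ) | ∀ t ∈ S n, φ t = 0}) :=
    ((isometry_e_mul n).comp (op_isometry hα)).isClosedEmbedding.isClosedMap _
      (isClosed_vanishing (S n))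
  have hV := isClosed_setOf_exists_tendsto (avg α n) (norm_avg_le α n) hR
  have hsub : (cocycleAlgebra hS : Set B) ⊆ {a | ∃ r ∈ (fun φ => e n * op α φ) ''
      {φ : C(S1, ℂ) | ∀ t ∈ S n, φ t = 0}, Tendsto (fun N => avg α n N a) atTop (𝓝 r)} := by
    intro b hb
    change b ∈ Submodule.span ℂ (monomials α S) at hb
    induction hb using Submodule.span_induction with
    | mem x hx =>
      obtain ⟨m, φ, hφ, rfl⟩ := hx
      refine ⟨_, ?_, tendsto_avg_monomial hα n m φ⟩
      split_ifs with h
      · subst h; exact ⟨φ, hφ, rfl⟩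
      · exact ⟨0, by simp, by simp⟩
    | zero => exact ⟨0, ⟨0, by simp, by simp⟩, by simp⟩
    | add x y _ _ hx hy =>
      obtain ⟨_, ⟨φ, hφ, rfl⟩, hx⟩ := hx
      obtain ⟨_, ⟨ψ, hψ, rfl⟩, hy⟩ := hy
      refine ⟨_, ⟨φ + ψ, fun t ht => by simp [hφ t ht, hψ t ht], rfl⟩, ?_⟩
      simpa [map_add, mul_add] using hx.add hy
    | smul c x _ hx =>
      obtain ⟨_, ⟨φ, hφ, rfl⟩, hx⟩ := hx
      refine ⟨_, ⟨c • φ, fun t ht => by simp [hφ t ht], rfl⟩, ?_⟩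
      simpa [map_smul] using hx.const_smul c
  obtain ⟨_, ⟨φ, hφ, rfl⟩, h⟩ := closure_minimal hsub hV ha
  exact ⟨φ, hφ, h⟩

/-- Closed subsets of the circle are zero sets of continuous functions. -/
theorem exists_zero_iff_mem {Z : Set S1} (hZ : IsClosed Z) :
    ∃ h : C(S1, ℂ), ∀ t, h t = 0 ↔ t ∈ Z := by
  rcases Z.eq_empty_or_nonempty with rfl | hne
  -- The empty set is separate because `Metric.infDist t ∅` is 0 by convention.
  · exact ⟨1, by simp⟩
  · refine ⟨⟨fun t => (Metric.infDist t Z : ℂ), by fun_prop⟩, fun t => ?_⟩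
    change (Metric.infDist t Z : ℂ) = 0 ↔ t ∈ Z
    rw [Complex.ofReal_eq_zero, ← hZ.mem_iff_infDist_zero hne]

/-! ### The set function of an intermediate algebra; basic algebras -/

section Irrational

variable {α : ℝ} (hα : Irrational (α / (2 * π)))

theorem mem_zeroSet {A : IntermediateAlgebra α} {n : ℤ} {t : S1} :
    t ∈ A.idealFunction.zeroSet n ↔ ∀ φ : C(S1, ℂ), e n * op α φ ∈ A.alg → φ t = 0 := Iff.rfl

theorem isClosed_zeroSet (A : IntermediateAlgebra α) (n : ℤ) :
    IsClosed (A.idealFunction.zeroSet n) := by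
  have : A.idealFunction.zeroSet n = ⋂ φ : {φ : C(S1, ℂ) // e n * op α φ ∈ A.alg},
      {t | φ.1 t = 0} := by
    ext t; simp [mem_zeroSet]
  rw [this]
  exact isClosed_iInter fun φ => isClosed_eq φ.1.continuous continuous_const

theorem op_mem (A : IntermediateAlgebra α) (φ : C(S1, ℂ)) : op α φ ∈ A.alg :=
  A.le (op_mem_CstarZ α φ)

/-- If φ and ψ witness that t + mα ∉ Z(n) and t ∉ Z(m), the product of their monomials has a
coefficient that is nonzero at t. The adjoint rule treats -n in the same way. -/
theorem isCocycle_zeroSet (A : IntermediateAlgebra α) : IsCocycle α A.idealFunction.zeroSet where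
  zero := by
    refine eq_empty_of_forall_notMem fun t ht => ?_
    have := ht 1 (show e 0 * op α 1 ∈ A.alg by simp [e_zero])
    simp at this
  neg n t ht φ hφ := by
    have h := star_mem (show e n * op α φ ∈ A.alg from hφ)
    rw [star_monomial] at h
    have := ht _ h
    rwa [shift_apply, ContinuousMap.star_apply, star_eq_zero] at this
  add n m t ht := by
    by_contra! hcon
    simp only [mem_zeroSet, not_forall] at hcon
    obtain ⟨⟨φ, hφ, h1⟩, ψ, hψ, h2⟩ := hcon
    have h := mul_mem hφ hψ
    rw [monomial_mul] at h
    have := ht _ h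
    rw [ContinuousMap.mul_apply, shift_apply] at this
    exact mul_ne_zero h1 h2 this

/-- The ideal of functions `φ` with `φ̂ ∈ 𝔠(n)`. -/
def symbolIdeal (A : IntermediateAlgebra α) (n : ℤ) : Ideal C(S1, ℂ) :=
  (A.idealFunction.ideal n).comap (hat α)

theorem mem_symbolIdeal {A : IntermediateAlgebra α} {n : ℤ} {φ : C(S1, ℂ)} :
    φ ∈ symbolIdeal A n ↔ e n * op α φ ∈ A.alg := Iff.rfl

theorem isClosed_symbolIdeal (A : IntermediateAlgebra α) (n : ℤ) :
    IsClosed (symbolIdeal A n : Set C(S1, ℂ)) :=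
  A.isClosed.preimage (continuous_const.mul (continuous_op α))

theorem setOfIdeal_symbolIdeal (A : IntermediateAlgebra α) (n : ℤ) :
    ContinuousMap.setOfIdeal (symbolIdeal A n) = (A.idealFunction.zeroSet n)ᶜ := by
  ext t
  rw [← not_iff_not, ContinuousMap.notMem_setOfIdeal, mem_compl_iff, not_not, mem_zeroSet]
  exact ⟨fun h φ hφ => h hφ, fun h φ hφ => h φ hφ⟩

/-- A monomial `e^{inx} φ̂` belongs to `𝒜` iff `φ` vanishes on the set function of `𝒜`. -/
theorem monomial_mem_iff {A : IntermediateAlgebra α} {n : ℤ} {φ : C(S1, ℂ)} :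
    e n * op α φ ∈ A.alg ↔ ∀ t ∈ A.idealFunction.zeroSet n, φ t = 0 := by
  -- A closed ideal of C(S¹) consists of all functions vanishing on its zero set.
  rw [← mem_symbolIdeal, ← ContinuousMap.idealOfSet_ofIdeal_isClosed (isClosed_symbolIdeal A n),
    setOfIdeal_symbolIdeal, ContinuousMap.mem_idealOfSet, compl_compl]

theorem avg_mem (A : IntermediateAlgebra α) {a : B} (ha : a ∈ A.alg) (n : ℤ) (N : ℕ) :
    avg α n N a ∈ A.alg := by
  rw [avg_apply]
  exact SMulMemClass.smul_mem _ (sum_mem fun k _ => SMulMemClass.smul_mem _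
    (mul_mem (op_mem A _) (mul_mem ha (op_mem A _))))

include hα

theorem coe_mem_ideal_iff {A : IntermediateAlgebra α} {n : ℤ} {η : CstarZ α} :
    η ∈ A.idealFunction.ideal n ↔
      ∃ φ : C(S1, ℂ), hat α φ = η ∧ ∀ t ∈ A.idealFunction.zeroSet n, φ t = 0 := by
  constructor
  · intro h
    obtain ⟨φ, rfl⟩ := hat_surjective hα η
    exact ⟨φ, rfl, monomial_mem_iff.mp h⟩
  · rintro ⟨φ, rfl, h⟩
    exact monomial_mem_iff.mpr h

theorem mem_support_iff {A : IntermediateAlgebra α} {n : ℤ} :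
    n ∈ A.idealFunction.support ↔ A.idealFunction.zeroSet n ≠ univ := by
  rw [IdealFunction.support, mem_ofPred_eq, not_iff_not]
  constructor
  · intro h
    refine eq_univ_of_forall fun t φ hφ => ?_
    rw [h, Ideal.mem_bot, ← map_zero (hat α)] at hφ
    rw [hat_injective hα hφ]
    rfl
  · intro h
    refine (Submodule.eq_bot_iff _).mpr fun η hη => ?_
    obtain ⟨φ, rfl, hφ⟩ := (coe_mem_ideal_iff hα).mp hη
    have : φ = 0 := by
      ext t
      exact hφ t (h ▸ mem_univ t)
    rw [this, map_zero]

/-- The limit exists because `a` lies in the crossed product; it stays in 𝒜 because 𝒜 is closed and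
contains λ₁, hence all the averages. -/
theorem exists_component (A : IntermediateAlgebra α) {a : B} (ha : a ∈ A.alg) (n : ℤ) :
    ∃ φ : C(S1, ℂ), e n * op α φ ∈ A.alg ∧
      Tendsto (fun N => avg α n N a) atTop (𝓝 (e n * op α φ)) := by
  obtain ⟨φ, -, h⟩ := exists_tendsto_avg hα (isCocycle_empty α) (crossedProduct_le α (A.ge ha)) n
  exact ⟨φ, A.isClosed.mem_of_tendsto h (Eventually.of_forall fun N => avg_mem A ha n N), h⟩

theorem monomial_injective (n : ℤ) : Function.Injective fun φ : C(S1, ℂ) => e n * op α φ :=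
  (e_mul_injective n).comp (op_injective hα)

/-- The algebra generated by the monomials of a cocycle of closed sets has this cocycle as its set
function. -/
theorem zeroSet_eq {A : IntermediateAlgebra α} {S : ℤ → Set S1} (hS : IsCocycle α S)
    (hcl : ∀ n, IsClosed (S n)) (hA : A.alg = (cocycleAlgebra hS).topologicalClosure) (n : ℤ) :
    A.idealFunction.zeroSet n = S n := by
  apply Subset.antisymm
  · intro t ht
    obtain ⟨h, hh⟩ := exists_zero_iff_mem (hcl n)
    refine (hh t).mp (ht h ?_)
    change e n * op α h ∈ A.alg
    rw [hA]
    exact StarSubalgebra.le_topologicalClosure _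
      (monomial_mem_cocycleAlgebra hS fun t ht => (hh t).mpr ht)
  · intro t ht φ hφ
    change e n * op α φ ∈ A.alg at hφ
    rw [hA] at hφ
    -- The n-th component of this monomial is the monomial itself, while membership in the closure
    -- forces that component's symbol to vanish on `S n`.
    obtain ⟨ψ, hψ, h⟩ := exists_tendsto_avg hα hS hφ n
    have h1 := tendsto_avg_monomial hα n n φ
    rw [if_pos rfl] at h1
    rw [monomial_injective hα n (tendsto_nhds_unique h1 h)]
    exact hψ t ht

omit hα in
theorem mem_rot {k : ℤ} {P : Set S1} {t : S1} : t ∈ rot α k P ↔ t - k • (α : S1) ∈ P := by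
  constructor
  · rintro ⟨s, hs, rfl⟩
    simpa using hs
  · intro h
    exact ⟨_, h, by simp⟩

omit hα in
-- One description for both signs: t + jqα visits P for some j in the half-open interval between 0
-- and m/q. If q ∤ m the condition is vacuous, which includes q = 0 with m ≠ 0.
theorem mem_basicSet {q : ℕ} {P : Set S1} {m : ℤ} {t : S1} :
    t ∈ basicSet α q P m ↔ m ≠ 0 ∧ ((q : ℤ) ∣ m →
      ∃ j : ℤ, ((0 ≤ j ∧ j < m / q) ∨ (m / q ≤ j ∧ j < 0)) ∧ t + (j * q) • (α : S1) ∈ P) := by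
  unfold basicSet
  split_ifs with h0 hq hm
  · simp [h0]
  · have hd : 0 ≤ m / q := Int.ediv_nonneg hm.le (by positivity)
    simp only [mem_iUnion, mem_rot, mem_Ico, exists_prop]
    constructor
    · rintro ⟨j, hj, h⟩
      exact ⟨h0, fun _ => ⟨j, Or.inl hj, by rwa [neg_smul, sub_neg_eq_add] at h⟩⟩
    · rintro ⟨-, h⟩
      obtain ⟨j, hj | hj, h⟩ := h hq
      · exact ⟨j, hj, by rwa [neg_smul, sub_neg_eq_add]⟩
      · omega
  · obtain ⟨a, rfl⟩ := hq
    have hq0 : (q : ℤ) ≠ 0 := left_ne_zero_of_mul h0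
    have hd : (q * a) / (q : ℤ) = a := Int.mul_ediv_cancel_left a hq0
    have hd' : (-(q * a)) / (q : ℤ) = -a := by
      rw [← mul_neg]; exact Int.mul_ediv_cancel_left _ hq0
    have ha : a ≤ 0 := by
      by_contra! h
      exact hm (mul_pos (by positivity) h)
    simp only [mem_iUnion, mem_rot, mem_Icc, exists_prop, hd, hd']
    constructor
    · rintro ⟨j, hj, h⟩
      exact ⟨h0, fun _ => ⟨-j, Or.inr (by omega), by
        rwa [neg_mul, neg_smul, ← sub_eq_add_neg]⟩⟩
    · rintro ⟨-, h⟩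
      obtain ⟨j, hj | hj, h⟩ := h ⟨a, rfl⟩
      · omega
      · exact ⟨-j, by omega, by rwa [neg_mul, neg_smul, sub_neg_eq_add]⟩
  · simp [h0, hq]

omit hα in
theorem isCocycle_basicSet (q : ℕ) (P : Set S1) : IsCocycle α (basicSet α q P) where
  zero := by simp [basicSet]
  neg n t ht := by
    rw [mem_basicSet] at ht ⊢
    refine ⟨by simpa using ht.1, fun hq => ?_⟩
    obtain ⟨j, hj, h⟩ := ht.2 (by simpa using hq)
    obtain ⟨a, rfl⟩ := hq
    have hq0 : (q : ℤ) ≠ 0 := by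
      intro h; simp [h] at ht
    rw [← mul_neg] at hj
    rw [Int.mul_ediv_cancel_left _ hq0] at hj ⊢
    refine ⟨j + a, by omega, ?_⟩
    rw [add_assoc, ← add_smul]
    convert h using 3
    ring
  add n m t ht := by
    rw [mem_basicSet] at ht
    by_cases hm : (q : ℤ) ∣ m
    swap
    · exact Or.inr (mem_basicSet.mpr ⟨by rintro rfl; simp at hm, fun h => absurd h hm⟩)
    by_cases hn : (q : ℤ) ∣ n
    swap
    · exact Or.inl (mem_basicSet.mpr ⟨by rintro rfl; simp at hn, fun h => absurd h hn⟩)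
    obtain ⟨j, hj, h⟩ := ht.2 (dvd_add hn hm)
    obtain ⟨a, rfl⟩ := hn
    obtain ⟨b, rfl⟩ := hm
    have hq0 : (q : ℤ) ≠ 0 := by
      intro h; simp [h] at ht
    rw [← mul_add, Int.mul_ediv_cancel_left _ hq0] at hj
    -- An index between 0 and a + b is either between 0 and b or, after subtracting b, between 0 and
    -- a, whatever the signs.
    by_cases hb : (0 ≤ j ∧ j < b) ∨ (b ≤ j ∧ j < 0)
    · refine Or.inr (mem_basicSet.mpr ⟨mul_ne_zero hq0 (by omega), fun _ => ⟨j, ?_, h⟩⟩)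
      rwa [Int.mul_ediv_cancel_left _ hq0]
    · refine Or.inl (mem_basicSet.mpr ⟨mul_ne_zero hq0 (by omega), fun _ => ⟨j - b, ?_, ?_⟩⟩)
      · rw [Int.mul_ediv_cancel_left _ hq0]; omega
      · rw [add_assoc, ← add_smul]
        convert h using 3
        ring

omit hα in
theorem isClosed_basicSet (q : ℕ) {P : Set S1} (hP : IsClosed P) (n : ℤ) :
    IsClosed (basicSet α q P n) := by
  have hrot : ∀ k, IsClosed (rot α k P) := fun k =>
    (Homeomorph.addRight (k • (α : S1))).isClosedMap _ hP
  unfold basicSet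
  split_ifs
  · exact isClosed_empty
  · exact (finite_Ico _ _).isClosed_biUnion fun j _ => hrot _
  · exact (finite_Icc _ _).isClosed_biUnion fun j _ => hrot _
  · exact isClosed_univ

/-- Since `hat` is an isometric bijection, the image ideal is already closed, and taking the closure
adds nothing. -/
theorem hat_mem_idealOfZeros_iff {P : Set S1} {φ : C(S1, ℂ)} :
    hat α φ ∈ (idealOfZeros α P).1 ↔ ∀ t ∈ P, φ t = 0 := by
  have himage : ((ContinuousMap.idealOfSet ℂ Pᶜ).map (hat α) : Set (CstarZ α)) =
      hat α '' {φ | ∀ t ∈ P, φ t = 0} := by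
    ext η
    rw [SetLike.mem_coe, Ideal.mem_map_iff_of_surjective (hat α) (hat_surjective hα)]
    simp [ContinuousMap.mem_idealOfSet]
  have hcl : IsClosed (hat α '' {φ : C(S1, ℂ) | ∀ t ∈ P, φ t = 0}) :=
    (hat_isometry hα).isClosedEmbedding.isClosedMap _ (isClosed_vanishing P)
  rw [idealOfZeros, ← SetLike.mem_coe, Ideal.coe_closure, himage, hcl.closure_eq]
  exact (hat_injective hα).mem_set_image

theorem basicAlgebra_alg (q : ℕ) (P : Set S1) :
    (basicAlgebra α q P).alg = (cocycleAlgebra (isCocycle_basicSet (α := α) q P)).topologicalClosure := by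
  apply le_antisymm
  · refine StarSubalgebra.topologicalClosure_mono (StarAlgebra.adjoin_le ?_)
    rintro _ ⟨n, η, hη, rfl⟩
    obtain ⟨φ, rfl⟩ := hat_surjective hα η
    exact monomial_mem_cocycleAlgebra _ ((hat_mem_idealOfZeros_iff hα).mp hη)
  · refine StarSubalgebra.topologicalClosure_mono fun a ha => ?_
    change a ∈ Submodule.span ℂ (monomials α (basicSet α q P)) at ha
    induction ha using Submodule.span_induction with
    | mem x hx =>
      obtain ⟨n, φ, hφ, rfl⟩ := hx
      exact StarAlgebra.subset_adjoin _ _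
        ⟨n, hat α φ, (hat_mem_idealOfZeros_iff hα).mpr hφ, rfl⟩
    | zero => exact zero_mem _
    | add x y _ _ hx hy => exact add_mem hx hy
    | smul c x _ hx => exact SMulMemClass.smul_mem c hx

/-- The set function of a basic algebra is the basic set function. -/
theorem zeroSet_basicAlgebra (q : ℕ) {P : Set S1} (hP : IsClosed P) (n : ℤ) :
    (basicAlgebra α q P).idealFunction.zeroSet n = basicSet α q P n :=
  zeroSet_eq hα _ (isClosed_basicSet q hP) (basicAlgebra_alg hα q P) n

end Irrational

/-! ### Small versus residual algebras, and joins -/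

section Irrational

variable {α : ℝ} (hα : Irrational (α / (2 * π)))

theorem interior_preimage_add_eq_empty {Z : Set S1} (hZ : interior Z = ∅) (s : S1) :
    interior ((fun t => t + s) ⁻¹' Z) = ∅ := by
  have := (Homeomorph.addRight s).preimage_interior Z
  rw [hZ, preimage_empty] at this
  exact this.symm

/-- If `𝔠̌(n)` has empty interior, then so do `𝔠̌(kn)` for all `k`. -/
theorem interior_zeroSet_mul_eq_empty (A : IntermediateAlgebra α) {n : ℤ}
    (h : interior (A.idealFunction.zeroSet n) = ∅) (k : ℤ) :
    interior (A.idealFunction.zeroSet (k * n)) = ∅ := by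
  have hS := isCocycle_zeroSet A
  have hnat : ∀ k : ℕ, interior (A.idealFunction.zeroSet (k * n)) = ∅ := by
    intro k
    induction k with
    | zero => simp [hS.zero]
    | succ k ih =>
      have hsub : A.idealFunction.zeroSet ((k + 1 : ℕ) * n) ⊆
          (fun t => t + n • (α : S1)) ⁻¹' A.idealFunction.zeroSet (k * n) ∪
            A.idealFunction.zeroSet n := by
        intro t ht
        rw [Nat.cast_succ, add_mul, one_mul] at ht
        exact hS.add _ _ t ht
      refine subset_empty_iff.mp ((interior_mono hsub).trans ?_)
      -- A union of two closed sets with empty interior has empty interior.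
      rw [interior_union_isClosed_of_interior_empty
        ((isClosed_zeroSet A _).preimage (continuous_add_const _)) h]
      exact (interior_preimage_add_eq_empty ih _).subset
  obtain ⟨m, rfl | rfl⟩ := k.eq_nat_or_neg
  · exact hnat m
  · have hsub : A.idealFunction.zeroSet (-(m : ℤ) * n) ⊆
        (fun t => t + (-(m * n)) • (α : S1)) ⁻¹' A.idealFunction.zeroSet (m * n) := by
      intro t ht
      rw [neg_mul] at ht
      exact hS.neg _ t ht
    exact subset_empty_iff.mp ((interior_mono hsub).trans
      (interior_preimage_add_eq_empty (hnat m) _).subset)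

include hα

/-- Otherwise no Z(kn) is the whole circle, and the support contains the infinitely many multiples
of n. -/
theorem IntermediateAlgebra.IsSmall.interior_nonempty {A : IntermediateAlgebra α} (hA : A.IsSmall)
    {n : ℤ} (hn : n ≠ 0) : (interior (A.idealFunction.zeroSet n)).Nonempty := by
  by_contra h
  rw [not_nonempty_iff_eq_empty] at h
  refine infinite_of_injective_forall_mem (f := fun k : ℤ => k * n)
    (mul_left_injective₀ hn) (fun k => ?_) hA
  rw [mem_support_iff hα]
  intro hk
  have := interior_zeroSet_mul_eq_empty A h k
  rw [hk, interior_univ] at this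
  exact empty_ne_univ this.symm

theorem alg_eq_CstarZ_iff {A : IntermediateAlgebra α} :
    A.alg = CstarZ α ↔ ∀ n : ℤ, n ≠ 0 → A.idealFunction.zeroSet n = univ := by
  constructor
  · refine fun h n hn => eq_univ_of_forall fun t φ hφ => ?_
    change e n * op α φ ∈ A.alg at hφ
    rw [h] at hφ
    obtain ⟨ψ, hψ⟩ := exists_op_eq hα hφ
    have h1 := tendsto_avg_monomial hα n 0 ψ
    rw [if_neg hn.symm, e_zero, one_mul, hψ] at h1
    have h2 := tendsto_avg_monomial hα n n φ
    rw [if_pos rfl] at h2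
    have h3 := tendsto_nhds_unique h2 h1
    rw [← mul_zero (e n), ← map_zero (op α)] at h3
    rw [monomial_injective hα n h3]
    rfl
  · refine fun h => le_antisymm (fun a ha => ?_) A.le
    choose φ hφ hlim using exists_component hα A ha
    have h0 : ∀ n, n ≠ 0 → φ n = 0 := fun n hn => by
      ext t
      exact monomial_mem_iff.mp (hφ n) t (h n hn ▸ mem_univ t)
    have heq : a = e 0 * op α (φ 0) := by
      refine eq_of_tendsto_avg _ hlim fun n => ?_
      have h1 := tendsto_avg_monomial hα n 0 (φ 0)
      split_ifs at h1 with hn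
      · subst hn; exact h1
      · rwa [h0 n (Ne.symm hn), map_zero, mul_zero]
    rw [heq, e_zero, one_mul]
    exact op_mem_CstarZ α _

theorem IntermediateAlgebra.IsSmall.not_isResidual {A : IntermediateAlgebra α} (hA : A.IsSmall) :
    ¬ A.IsResidual := by
  rintro ⟨hne, hres⟩
  rw [ne_eq, alg_eq_CstarZ_iff hα] at hne
  push Not at hne
  obtain ⟨n, hn, hn'⟩ := hne
  have h1 := hres n ((mem_support_iff hα).mpr hn')
  rw [(isClosed_zeroSet A n).isNowhereDense_iff] at h1
  exact (hA.interior_nonempty hα hn).ne_empty h1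

omit hα in
theorem basicSet_self {q : ℕ} (hq : q ≠ 0) (P : Set S1) : basicSet α q P q = P := by
  ext t
  have hq' : (q : ℤ) ≠ 0 := by exact_mod_cast hq
  rw [mem_basicSet, Int.ediv_self hq']
  constructor
  · rintro ⟨-, h⟩
    obtain ⟨j, hj, h⟩ := h dvd_rfl
    obtain rfl : j = 0 := by omega
    simpa using h
  · exact fun h => ⟨hq', fun _ => ⟨0, by simp, by simpa using h⟩⟩

theorem isSmall_basicAlgebra_zero {P : Set S1} (hP : IsClosed P) :
    (basicAlgebra α 0 P).IsSmall := by
  refine (finite_singleton (0 : ℤ)).subset fun m hm => ?_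
  rw [mem_support_iff hα, zeroSet_basicAlgebra hα 0 hP] at hm
  by_contra h0
  exact hm (by simp [basicSet, show m ≠ 0 from h0])

/-- Rotation by qα is again irrational, so every orbit meets the interior of P; compactness bounds
the return time by some M. Any window of 2M + 1 consecutive indices then contains a visit to P. -/
theorem isSmall_basicAlgebra_of_interior_nonempty {q : ℕ} (hq : q ≠ 0) {P : Set S1}
    (hP : IsClosed P) (hint : (interior P).Nonempty) : (basicAlgebra α q P).IsSmall := by
  have hirr : Irrational (((q : ℝ) * α) / (2 * π)) := by
    rw [mul_div_assoc]; exact hα.natCast_mul hq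
  have hcover : (univ : Set S1) ⊆ ⋃ k : ℤ, {t | t + (k * q) • (α : S1) ∈ interior P} := by
    intro t _
    obtain ⟨p, hp⟩ := hint
    have hopen : IsOpen {x : S1 | t + x ∈ interior P} :=
      isOpen_interior.preimage (by fun_prop)
    obtain ⟨k, hk⟩ := (denseRange_zsmul hirr).exists_mem_open hopen
      ⟨p - t, by simpa using hp⟩
    refine mem_iUnion.mpr ⟨k, ?_⟩
    have h1 : ((q * α : ℝ) : S1) = (q : ℤ) • (α : S1) := by
      rw [natCast_zsmul, ← AddCircle.coe_nsmul, nsmul_eq_mul]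
    rw [mem_ofPred_eq, h1, smul_smul] at hk
    exact hk
  obtain ⟨s, hs⟩ := isCompact_univ.elim_finite_subcover _
    (fun k => isOpen_interior.preimage (by fun_prop)) hcover
  obtain ⟨M, hM⟩ : ∃ M : ℤ, ∀ k ∈ s, |k| ≤ M :=
    ⟨∑ k ∈ s, |k|, fun k hk =>
      Finset.single_le_sum (f := fun k : ℤ => |k|) (fun _ _ => abs_nonneg _) hk⟩
  have hex : ∀ t : S1, ∃ k : ℤ, |k| ≤ M ∧ t + (k * q) • (α : S1) ∈ P := fun t => by
    have := hs (mem_univ t)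
    simp only [mem_iUnion, exists_prop] at this
    obtain ⟨k, hk, h⟩ := this
    exact ⟨k, hM k hk, interior_subset h⟩
  have hq' : (q : ℤ) ≠ 0 := by exact_mod_cast hq
  refine ((finite_Icc (-(2 * M + 1)) (2 * M + 1)).image fun a : ℤ => q * a).subset fun m hm => ?_
  rw [mem_support_iff hα, zeroSet_basicAlgebra hα q hP] at hm
  by_contra hcon
  refine hm (eq_univ_of_forall fun t => mem_basicSet.mpr ⟨?_, ?_⟩)
  · rintro rfl
    obtain ⟨k, hk, -⟩ := hex t
    exact hcon ⟨0, by have := abs_nonneg k; constructor <;> omega, by simp⟩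
  · rintro ⟨a, rfl⟩
    rw [Int.mul_ediv_cancel_left _ hq']
    have ha : ¬ (-(2 * M + 1) ≤ a ∧ a ≤ 2 * M + 1) := fun h => hcon ⟨a, h, rfl⟩
    have hshift : ∀ i : ℤ, ∃ k : ℤ, |k| ≤ M ∧ t + ((i + k) * q) • (α : S1) ∈ P := fun i => by
      obtain ⟨k, hk, h⟩ := hex (t + (i * q) • (α : S1))
      exact ⟨k, hk, by rwa [add_mul, add_smul, ← add_assoc]⟩
    rcases le_or_gt a 0 with h0 | h0
    -- The window [-2M-1, -1] lies in [a, 0).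
    · obtain ⟨k, hk, h⟩ := hshift (-(M + 1))
      rw [abs_le] at hk
      exact ⟨_, by omega, h⟩
    -- The window [0, 2M] lies in [0, a).
    · obtain ⟨k, hk, h⟩ := hshift M
      rw [abs_le] at hk
      exact ⟨_, by omega, h⟩

theorem isResidual_basicAlgebra_of_interior_eq_empty {q : ℕ} (hq : q ≠ 0) {P : Set S1}
    (hP : IsClosed P) (hint : interior P = ∅) : (basicAlgebra α q P).IsResidual := by
  have hq' : (q : ℤ) ≠ 0 := by exact_mod_cast hq
  have hself : (basicAlgebra α q P).idealFunction.zeroSet q = P := by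
    rw [zeroSet_basicAlgebra hα q hP, basicSet_self hq]
  refine ⟨fun h => ?_, fun n hn => ?_⟩
  · rw [alg_eq_CstarZ_iff hα] at h
    rw [← hself, h q hq', interior_univ] at hint
    exact empty_ne_univ hint.symm
  · rw [(isClosed_zeroSet _ n).isNowhereDense_iff]
    obtain ⟨a, rfl⟩ : (q : ℤ) ∣ n := by
      by_contra hd
      rw [mem_support_iff hα, zeroSet_basicAlgebra hα q hP] at hn
      refine hn (eq_univ_of_forall fun t => mem_basicSet.mpr ⟨?_, fun h => absurd h hd⟩)
      rintro rfl
      simp at hd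
    rw [mul_comm (q : ℤ) a]
    exact interior_zeroSet_mul_eq_empty _ (by rwa [hself]) a

theorem isSmall_basicAlgebra_iff (q : ℕ) {P : Set S1} (hP : IsClosed P) :
    (basicAlgebra α q P).IsSmall ↔ ¬ (basicAlgebra α q P).IsResidual := by
  refine ⟨fun h => h.not_isResidual hα, fun h => ?_⟩
  rcases eq_or_ne q 0 with rfl | hq
  · exact isSmall_basicAlgebra_zero hα hP
  · refine isSmall_basicAlgebra_of_interior_nonempty hα hq hP ?_
    by_contra hint
    exact h (isResidual_basicAlgebra_of_interior_eq_empty hα hq hP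
      (not_nonempty_iff_eq_empty.mp hint))

theorem monomial_one_mem_basicAlgebra {P : Set S1} (hP : IsClosed P) {φ : C(S1, ℂ)} :
    e 1 * op α φ ∈ (basicAlgebra α 1 P).alg ↔ ∀ t ∈ P, φ t = 0 := by
  rw [monomial_mem_iff, zeroSet_basicAlgebra hα 1 hP]
  have := basicSet_self (α := α) one_ne_zero P
  rw [Nat.cast_one] at this
  rw [this]

theorem coe_ne_zero : (α : S1) ≠ 0 := fun h => by
  have := (zsmul_eq_zero_iff hα (n := 1)).mp (by simpa using h)
  exact one_ne_zero this

/-- Take two disjoint balls as the sets P. A Urysohn function φ splits e^{ix} as e^{ix} φ̂ plus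
e^{ix} (1-φ)^, one summand in each algebra, so the join contains every power of e^{ix}. -/
theorem exists_isSmall_join_not_isSmall : ∃ A₁ A₂ : IntermediateAlgebra α,
    A₁.IsSmall ∧ A₂.IsSmall ∧ ¬ (A₁.join A₂).IsSmall := by
  have hr : 0 < ‖(α : S1)‖ / 3 := by
    have := norm_pos_iff.mpr (coe_ne_zero hα)
    positivity
  have hint : ∀ p : S1, (interior (Metric.closedBall p (‖(α : S1)‖ / 3))).Nonempty := fun p =>
    ⟨p, Metric.ball_subset_interior_closedBall (Metric.mem_ball_self hr)⟩
  have hdisj : Disjoint (Metric.closedBall (0 : S1) (‖(α : S1)‖ / 3))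
      (Metric.closedBall (α : S1) (‖(α : S1)‖ / 3)) := by
    refine Metric.closedBall_disjoint_closedBall ?_
    rw [dist_comm, dist_zero_right]
    linarith
  obtain ⟨f, hf0, hf1, -⟩ := exists_continuous_zero_one_of_isClosed
    Metric.isClosed_closedBall Metric.isClosed_closedBall hdisj
  let φ : C(S1, ℂ) := ⟨fun t => (f t : ℂ), by fun_prop⟩
  let A₁ := basicAlgebra α 1 (Metric.closedBall (0 : S1) (‖(α : S1)‖ / 3))
  let A₂ := basicAlgebra α 1 (Metric.closedBall (α : S1) (‖(α : S1)‖ / 3))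
  refine ⟨A₁, A₂,
    isSmall_basicAlgebra_of_interior_nonempty hα one_ne_zero Metric.isClosed_closedBall (hint _),
    isSmall_basicAlgebra_of_interior_nonempty hα one_ne_zero Metric.isClosed_closedBall (hint _),
    fun hsmall => ?_⟩
  have h1 : e 1 * op α φ ∈ (A₁.join A₂).alg :=
    (le_sup_left.trans (StarSubalgebra.le_topologicalClosure _) : A₁.alg ≤ (A₁.join A₂).alg)
      ((monomial_one_mem_basicAlgebra hα Metric.isClosed_closedBall).mpr fun t ht => by
        simpa [φ] using hf0 ht)
  have h2 : e 1 * op α (1 - φ) ∈ (A₁.join A₂).alg :=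
    (le_sup_right.trans (StarSubalgebra.le_topologicalClosure _) : A₂.alg ≤ (A₁.join A₂).alg)
      ((monomial_one_mem_basicAlgebra hα Metric.isClosed_closedBall).mpr fun t ht => by
        have : f t = 1 := hf1 ht
        simp [φ, this])
  have h3 : e 1 ∈ (A₁.join A₂).alg := by
    have := add_mem h1 h2
    rwa [← mul_add, ← map_add, add_sub_cancel, map_one, mul_one] at this
  refine infinite_of_injective_forall_mem (f := fun k : ℕ => (k : ℤ)) Nat.cast_injective
    (fun k => ?_) hsmall
  rw [mem_support_iff hα]
  intro hk
  have h4 : e (k : ℤ) * op α 1 ∈ (A₁.join A₂).alg := by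
    rw [map_one, mul_one, e_natCast]
    exact pow_mem h3 k
  have := monomial_mem_iff.mp h4 0 (hk ▸ mem_univ _)
  simp at this

end Irrational

/-! ### Small algebras as modules over C*_r(ℤ) -/

instance (α : ℝ) : Nontrivial (CstarZ α) := by
  refine ⟨⟨0, 1, fun h => fourierLp_ne_zero 0 ?_⟩⟩
  have := congrArg (fun η : CstarZ α => (η : B) (fourierLp 2 0)) h
  exact this.symm

section Irrational

variable {α : ℝ} (hα : Irrational (α / (2 * π)))

theorem monomial_eq_smul (α : ℝ) (φ : C(S1, ℂ)) (n : ℤ) :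
    e n * op α φ = hat α (shift (-(n • (α : S1))) φ) • e n := by
  rw [RotationAlgebra.smul_eq_mul, coe_hat, e_mul_op]

theorem monomial_mul_eq_smul (α : ℝ) (φ ψ : C(S1, ℂ)) (n : ℤ) :
    e n * op α (φ * ψ) = hat α (shift (-(n • (α : S1))) φ) • (e n * op α ψ) := by
  rw [RotationAlgebra.smul_eq_mul, coe_hat, map_mul, ← mul_assoc, e_mul_op, mul_assoc]

theorem isClosed_toModule (A : IntermediateAlgebra α) : IsClosed (A.toModule : Set B) :=
  A.isClosed

/-- If `h` has zero set `𝔠̌(n)`, then `e^{inx} ĥ` topologically generates the submodule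
`e^{inx} 𝔠(n)`. -/
theorem monomial_mem_topologicalClosure_span {A : IntermediateAlgebra α} {n : ℤ} {h : C(S1, ℂ)}
    (hh : ∀ t, h t = 0 ↔ t ∈ A.idealFunction.zeroSet n) {φ : C(S1, ℂ)}
    (hφ : e n * op α φ ∈ A.alg) :
    e n * op α φ ∈ (Submodule.span (CstarZ α) {e n * op α h}).topologicalClosure := by
  -- The closed ideal generated by `h` consists of all functions vanishing on the zeros of `h`.
  have h1 : φ ∈ closure (Ideal.span {h} : Set C(S1, ℂ)) := by
    rw [← Ideal.coe_closure, ← ContinuousMap.idealOfSet_ofIdeal_eq_closure, SetLike.mem_coe,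
      ContinuousMap.mem_idealOfSet]
    intro t ht
    rw [mem_compl_iff, ContinuousMap.notMem_setOfIdeal] at ht
    exact monomial_mem_iff.mp hφ t ((hh t).mp (ht (Ideal.mem_span_singleton_self h)))
  have hmaps : MapsTo (fun φ => e n * op α φ) (Ideal.span {h} : Set C(S1, ℂ))
      (Submodule.span (CstarZ α) {e n * op α h} : Set B) := by
    intro φ hφ
    obtain ⟨g, rfl⟩ := Ideal.mem_span_singleton'.mp hφ
    simp only [monomial_mul_eq_smul]
    exact Submodule.smul_mem _ _ (Submodule.mem_span_singleton_self _)
  exact hmaps.closure (continuous_const.mul (continuous_op α)) h1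

include hα

theorem tendsto_avg_sum {s : Finset ℤ} {φ : ℤ → C(S1, ℂ)} (hφ : ∀ n ∉ s, φ n = 0) (m : ℤ) :
    Tendsto (fun N => avg α m N (∑ n ∈ s, e n * op α (φ n))) atTop (𝓝 (e m * op α (φ m))) := by
  simp only [map_sum]
  have h := tendsto_finsetSum s fun n _ => tendsto_avg_monomial hα m n (φ n)
  rw [Finset.sum_ite_eq' s m] at h
  split_ifs at h with hm
  · exact h
  · rwa [hφ m hm, map_zero, mul_zero]

theorem eq_zero_of_notMem_support {A : IntermediateAlgebra α} {n : ℤ}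
    (hn : n ∉ A.idealFunction.support) {φ : C(S1, ℂ)} (hφ : e n * op α φ ∈ A.alg) : φ = 0 := by
  rw [mem_support_iff hα, not_not] at hn
  ext t
  exact monomial_mem_iff.mp hφ t (hn ▸ mem_univ t)

/-- The elements of a small algebra are polynomials. -/
theorem IntermediateAlgebra.IsSmall.exists_eq_sum {A : IntermediateAlgebra α} (hA : A.IsSmall)
    {a : B} (ha : a ∈ A.alg) : ∃ φ : ℤ → C(S1, ℂ), (∀ n, e n * op α (φ n) ∈ A.alg) ∧
      a = ∑ n ∈ Set.Finite.toFinset hA, e n * op α (φ n) := by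
  choose φ hφ hlim using exists_component hα A ha
  refine ⟨φ, hφ, eq_of_tendsto_avg _ hlim fun m => tendsto_avg_sum hα (fun n hn => ?_) m⟩
  exact eq_zero_of_notMem_support hα (mt (Set.Finite.mem_toFinset hA).mpr hn) (hφ n)

theorem IntermediateAlgebra.IsSmall.mem_iff {A : IntermediateAlgebra α} (hA : A.IsSmall) (a : B) :
    a ∈ A.alg ↔ ∃! η : ℤ → CstarZ α, (∀ n, η n ∈ A.idealFunction.ideal n) ∧
      a = ∑ n ∈ Set.Finite.toFinset hA, e n * (η n : B) := by
  constructor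
  · intro ha
    obtain ⟨φ, hφ, hsum⟩ := hA.exists_eq_sum hα ha
    refine ⟨fun n => hat α (φ n), ⟨hφ, hsum⟩, ?_⟩
    rintro η ⟨hη, hη'⟩
    choose ψ hψ using fun n => hat_surjective hα (η n)
    obtain rfl : η = fun n => hat α (ψ n) := funext fun n => (hψ n).symm
    funext n
    congr 1
    -- Both coefficient families give the n-th component of `a`. Off the support the ideals are
    -- zero, so uniqueness holds for all integers n.
    apply monomial_injective hα n
    have h1 := tendsto_avg_sum hα (s := hA.toFinset)
      (fun n hn => eq_zero_of_notMem_support hα (mt (Set.Finite.mem_toFinset hA).mpr hn) (hφ n)) n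
    have h2 := tendsto_avg_sum hα (s := hA.toFinset) (φ := ψ)
      (fun n hn => eq_zero_of_notMem_support hα (mt (Set.Finite.mem_toFinset hA).mpr hn) (hη n)) n
    simp only [coe_hat] at hη'
    rw [← hsum] at h1
    rw [← hη'] at h2
    exact tendsto_nhds_unique h2 h1
  · rintro ⟨η, ⟨hη, rfl⟩, -⟩
    exact sum_mem fun n _ => hη n

/-- One generator e^{inx} ĥₙ per degree suffices topologically, with hₙ vanishing exactly on Z(n).
For the rank, 𝒜 embeds in the larger module spanned by the finitely many e^{inx}, which themselves
need not lie in 𝒜. -/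
theorem IntermediateAlgebra.IsSmall.isFiniteDimensional {A : IntermediateAlgebra α}
    (hA : A.IsSmall) : A.IsFiniteDimensional := by
  classical
  refine ⟨?_, ?_⟩
  · choose h hh using fun n => exists_zero_iff_mem (isClosed_zeroSet A n)
    refine ⟨hA.toFinset.image fun n => e n * op α (h n), le_antisymm ?_ fun a ha => ?_⟩
    · refine Submodule.topologicalClosure_minimal _ (Submodule.span_le.mpr ?_)
        (isClosed_toModule A)
      intro x hx
      obtain ⟨n, -, rfl⟩ := Finset.mem_image.mp (Finset.mem_coe.mp hx)
      exact monomial_mem_iff.mpr fun t ht => (hh n t).mpr ht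
    · obtain ⟨φ, hφ, rfl⟩ := hA.exists_eq_sum hα ha
      refine sum_mem fun n hn => ?_
      refine Submodule.topologicalClosure_mono (Submodule.span_mono ?_)
        (monomial_mem_topologicalClosure_span (hh n) (hφ n))
      exact singleton_subset_iff.mpr (Finset.mem_coe.mpr (Finset.mem_image_of_mem _ hn))
  · have hle : A.toModule ≤ Submodule.span (CstarZ α) (hA.toFinset.image e : Set B) := by
      intro a ha
      obtain ⟨φ, hφ, rfl⟩ := hA.exists_eq_sum hα ha
      refine sum_mem fun n hn => ?_
      rw [monomial_eq_smul]
      exact Submodule.smul_mem _ _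
        (Submodule.subset_span (Finset.mem_coe.mpr (Finset.mem_image_of_mem _ hn)))
    calc Module.rank (CstarZ α) A.toModule
        ≤ Module.rank (CstarZ α) (Submodule.span (CstarZ α) (hA.toFinset.image e : Set B)) :=
          Submodule.rank_mono hle
      _ ≤ _ := rank_span_finset_le _
      _ < Cardinal.aleph0 := Cardinal.natCast_lt_aleph0

end Irrational

/-! ### Centers of the algebras with P ∪ τP = S¹ -/

section Irrational

variable {α : ℝ} (hα : Irrational (α / (2 * π)))

theorem mem_or_sub_mem {P : Set S1} (hU : P ∪ rot α 1 P = univ) (t : S1) :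
    t ∈ P ∨ t - (α : S1) ∈ P := by
  have : t ∈ P ∪ rot α 1 P := hU ▸ mem_univ t
  simpa [mem_rot] using this

/-- The points at which the monomials of `𝒜_{1,P}` may be nonzero, if `P ∪ τP = S¹`. -/
theorem notMem_basicSet_one {P : Set S1} (hU : P ∪ rot α 1 P = univ) {n : ℤ} {t : S1}
    (ht : t ∉ basicSet α 1 P n) : n = 0 ∨ (n = 1 ∧ t ∉ P) ∨ (n = -1 ∧ t - (α : S1) ∉ P) := by
  rw [mem_basicSet] at ht
  push Not at ht
  simp only [Nat.cast_one, Int.ediv_one, mul_one, isUnit_one, IsUnit.dvd, true_and] at ht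
  rcases eq_or_ne n 0 with h0 | h0
  · exact Or.inl h0
  right
  replace ht := ht h0
  rcases lt_or_gt_of_ne h0 with hneg | hpos
  · have h1 := ht (-1) (by omega)
    rw [neg_one_zsmul, ← sub_eq_add_neg] at h1
    refine Or.inr ⟨?_, h1⟩
    by_contra hn
    -- If n ≤ -2, both t - α and t - 2α avoid P, so t - α is outside P ∪ τP.
    have h2 := ht (-2) (by omega)
    refine ((mem_or_sub_mem hU (t - (α : S1))).resolve_left h1 |> fun h => h2 ?_)
    convert h using 1
    rw [neg_smul, two_smul]
    abel
  · have h1 := ht 0 (by omega)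
    rw [zero_smul, add_zero] at h1
    refine Or.inl ⟨?_, h1⟩
    by_contra hn
    -- If n ≥ 2, both t and t + α avoid P, so t + α is outside P ∪ τP.
    have h2 := ht 1 (by omega)
    rw [one_smul] at h2
    have := (mem_or_sub_mem hU (t + (α : S1))).resolve_left h2
    rw [add_sub_cancel_right] at this
    exact h1 this

theorem op_algebraMap (c : ℂ) : op α (algebraMap ℂ C(S1, ℂ) c) = algebraMap ℂ B c :=
  AlgHomClass.commutes (op α) c

include hα

theorem exists_ne_of_isOpen {U : Set S1} (hU : IsOpen U) {t : S1} (ht : t ∈ U) :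
    ∃ s ∈ U, s ≠ t := by
  by_contra! h
  have hUt : U = {t} := Subset.antisymm h (singleton_subset_iff.mpr ht)
  have hclopen : IsClopen ({t} : Set S1) := ⟨isClosed_singleton, hUt ▸ hU⟩
  have huniv := hclopen.eq_univ (singleton_nonempty t)
  have h1 : t + (α : S1) ∈ ({t} : Set S1) := huniv ▸ mem_univ _
  exact coe_ne_zero hα (by simpa using h1)

variable {P : Set S1} (hP : IsClosed P) (hne : P ≠ univ)
include hP hne

/-- If λ₁ commuted with e^{ix} ĥ, evaluation at a point where h ≠ 0 would give e^{iα} = 1. -/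
theorem center_basicAlgebra_ne_top : Subalgebra.center ℂ (basicAlgebra α 1 P).alg ≠ ⊤ := by
  intro htop
  obtain ⟨h, hh⟩ := exists_zero_iff_mem hP
  obtain ⟨t, ht⟩ := (ne_univ_iff_exists_notMem P).mp hne
  have hmem : e 1 * op α h ∈ (basicAlgebra α 1 P).alg :=
    (monomial_one_mem_basicAlgebra hα hP).mpr fun t ht => (hh t).mpr ht
  have hc : (⟨_, hmem⟩ : (basicAlgebra α 1 P).alg) ∈ Subalgebra.center ℂ (basicAlgebra α 1 P).alg :=
    htop ▸ Algebra.mem_top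
  have hcomm := congrArg Subtype.val (Subalgebra.mem_center_iff.mp hc ⟨_, op_mem _ (fourier 1)⟩)
  change op α (fourier 1) * (e 1 * op α h) = e 1 * op α h * op α (fourier 1) at hcomm
  rw [← mul_assoc, op_mul_e, mul_assoc, mul_assoc, ← map_mul, ← map_mul] at hcomm
  have := DFunLike.congr_fun (monomial_injective hα 1 hcomm) t
  have ht' : h t ≠ 0 := fun h0 => ht ((hh t).mp h0)
  rw [ContinuousMap.mul_apply, ContinuousMap.mul_apply, shift_apply, fourier_apply_add,
    mul_comm] at this
  have h2 := mul_left_cancel₀ ht' this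
  have h3 : (fourier 1 t : ℂ) ≠ 0 := by
    rw [← norm_ne_zero_iff, norm_fourier_apply]; exact one_ne_zero
  exact fourier_one_zsmul_ne_one hα one_ne_zero (mul_left_cancel₀ h3 (h2.trans (mul_one _).symm))

variable (hU : P ∪ rot α 1 P = univ)
include hU

omit hne in
theorem isSmall_basicAlgebra_one : (basicAlgebra α 1 P).IsSmall := by
  refine isSmall_basicAlgebra_of_interior_nonempty hα one_ne_zero hP ?_
  by_contra hint
  rw [not_nonempty_iff_eq_empty] at hint
  have hrot : rot α 1 P = (fun t => t + -(α : S1)) ⁻¹' P := by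
    ext t
    rw [mem_rot, one_smul, sub_eq_add_neg]
    rfl
  have h1 := interior_union_isClosed_of_interior_empty hP
    (interior_preimage_add_eq_empty hint (-(α : S1)))
  rw [← hrot, hU, hint, interior_univ] at h1
  exact empty_ne_univ h1.symm

/-- Take g vanishing on P and ψ(t) = g(t) + g(t-α). For t ∉ P the covering hypothesis puts t - α and
t + α in P, so ψ(t) = g(t) = ψ(t+α). This is the invariance needed to commute with monomials of
degree ±1. -/
theorem center_basicAlgebra_ne_bot : Subalgebra.center ℂ (basicAlgebra α 1 P).alg ≠ ⊥ := by
  intro hbot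
  obtain ⟨t₀, ht₀⟩ := (ne_univ_iff_exists_notMem P).mp hne
  obtain ⟨t₁, ht₁, hne₁⟩ := exists_ne_of_isOpen hα hP.isOpen_compl ht₀
  -- The extra zero at t₀ ∉ P makes ψ nonconstant: it vanishes at t₀ but not at t₁.
  obtain ⟨g, hg⟩ := exists_zero_iff_mem (hP.union (isClosed_singleton (x := t₀)))
  have hgP : ∀ t ∈ P, g t = 0 := fun t ht => (hg t).mpr (Or.inl ht)
  let ψ : C(S1, ℂ) := g + shift (-(α : S1)) g
  have hψ : ∀ t, ψ t = g t + g (t - (α : S1)) := fun t => by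
    simp [ψ, sub_eq_add_neg]
  have hψ' : ∀ t, t ∉ P → ψ t = g t := fun t ht => by
    rw [hψ, hgP _ ((mem_or_sub_mem hU t).resolve_left ht), add_zero]
  have hinv : ∀ t, t ∉ P → ψ (t + (α : S1)) = ψ t := fun t ht => by
    have h1 := mem_or_sub_mem hU (t + (α : S1))
    rw [add_sub_cancel_right] at h1
    rw [hψ' t ht, hψ, hgP _ (h1.resolve_right ht), add_sub_cancel_right, zero_add]
  have hmono : ∀ n (φ : C(S1, ℂ)), e n * op α φ ∈ (basicAlgebra α 1 P).alg →
      e n * op α φ * op α ψ = op α ψ * (e n * op α φ) := by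
    intro n φ hφ
    rw [← mul_assoc, op_mul_e, mul_assoc, mul_assoc, ← map_mul, ← map_mul]
    congr 2
    ext t
    rw [ContinuousMap.mul_apply, ContinuousMap.mul_apply, shift_apply, mul_comm]
    by_cases ht : t ∈ basicSet α 1 P n
    · rw [monomial_mem_iff.mp hφ t (by rwa [zeroSet_basicAlgebra hα 1 hP]), mul_zero, mul_zero]
    · congr 1
      rcases notMem_basicSet_one hU ht with rfl | ⟨rfl, h⟩ | ⟨rfl, h⟩
      · simp
      · rw [one_smul, hinv t h]
      · rw [neg_one_zsmul, ← sub_eq_add_neg, ← hinv _ h, sub_add_cancel]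
  have hcenter : (⟨_, op_mem _ ψ⟩ : (basicAlgebra α 1 P).alg) ∈
      Subalgebra.center ℂ (basicAlgebra α 1 P).alg := by
    refine Subalgebra.mem_center_iff.mpr fun a => Subtype.ext ?_
    change (a : B) * op α ψ = op α ψ * a
    obtain ⟨φ, hφ, ha⟩ := (isSmall_basicAlgebra_one hα hP hU).exists_eq_sum hα a.2
    rw [ha, Finset.sum_mul, Finset.mul_sum]
    exact Finset.sum_congr rfl fun n _ => hmono n _ (hφ n)
  rw [hbot] at hcenter
  obtain ⟨c, hc⟩ := Algebra.mem_bot.mp hcenter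
  have hc' : algebraMap ℂ B c = op α ψ := congrArg Subtype.val hc
  rw [← op_algebraMap] at hc'
  have hconst : ∀ t, ψ t = c := fun t => by
    rw [← op_injective hα hc']; simp
  have h0 : ψ t₀ = 0 := by rw [hψ' _ ht₀, (hg t₀).mpr (Or.inr rfl)]
  have h1 : ψ t₁ ≠ 0 := by
    rw [hψ' _ ht₁, ne_eq, hg]
    rintro (h | h)
    · exact ht₁ h
    · exact hne₁ h
  exact h1 ((hconst t₁).trans ((hconst t₀).symm.trans h0))

omit hP hne hU

theorem not_countable_isSmall_center :
    ¬ {A : IntermediateAlgebra α | A.IsSmall ∧ Subalgebra.center ℂ A.alg ≠ ⊥ ∧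
      Subalgebra.center ℂ A.alg ≠ ⊤}.Countable := by
  intro hcount
  have hα0 := norm_pos_iff.mpr (coe_ne_zero hα)
  -- With this radius the ball about 0 is disjoint from its translate by α, so Q ∪ τQ is the whole
  -- circle.
  obtain ⟨r, hr⟩ : ∃ r, r = ‖(α : S1)‖ / 2 := ⟨_, rfl⟩
  have hr0 : 0 < min r (2 * π) := lt_min (by rw [hr]; positivity) Real.two_pi_pos
  -- The point y is the only point of `Q y` inside the ball, so the algebra determines it; the bound
  -- y < 2π then recovers the real number.
  let Q : ℝ → Set S1 := fun y => (Metric.ball (0 : S1) r)ᶜ ∪ {(y : S1)}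
  have hQ : ∀ y, IsClosed (Q y) := fun y => Metric.isOpen_ball.isClosed_compl.union isClosed_singleton
  have hball : ∀ y ∈ Ioo 0 (min r (2 * π)), (y : S1) ∈ Metric.ball (0 : S1) r := fun y hy => by
    rw [mem_ball_zero_iff]
    calc ‖(y : S1)‖ ≤ ‖y‖ := QuotientAddGroup.norm_mk_le_norm
      _ = y := Real.norm_of_nonneg hy.1.le
      _ < r := hy.2.trans_le (min_le_left _ _)
  have hmaps : MapsTo (fun y => basicAlgebra α 1 (Q y)) (Ioo 0 (min r (2 * π)))
      {A : IntermediateAlgebra α | A.IsSmall ∧ Subalgebra.center ℂ A.alg ≠ ⊥ ∧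
        Subalgebra.center ℂ A.alg ≠ ⊤} := by
    intro y hy
    have hne : Q y ≠ univ := by
      obtain ⟨s, hs, hsy⟩ := exists_ne_of_isOpen hα Metric.isOpen_ball (hball y hy)
      refine (ne_univ_iff_exists_notMem _).mpr ⟨s, ?_⟩
      rintro (h | h)
      · exact h hs
      · exact hsy h
    have hU : Q y ∪ rot α 1 (Q y) = univ := by
      refine eq_univ_of_forall fun t => or_iff_not_imp_left.mpr fun ht => ?_
      have ht' : t ∈ Metric.ball (0 : S1) r := by
        by_contra h
        exact ht (Or.inl h)
      rw [mem_rot, one_smul]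
      refine Or.inl fun h => ?_
      rw [mem_ball_zero_iff] at ht' h
      have := norm_sub_le t (t - (α : S1))
      rw [sub_sub_cancel] at this
      linarith
    exact ⟨isSmall_basicAlgebra_one hα (hQ y) hU, center_basicAlgebra_ne_bot hα (hQ y) hne hU,
      center_basicAlgebra_ne_top hα (hQ y) hne⟩
  have hinj : InjOn (fun y => basicAlgebra α 1 (Q y)) (Ioo 0 (min r (2 * π))) := by
    intro y hy z hz hyz
    have hset : Q y = Q z := by
      have h : ∀ y, (basicAlgebra α 1 (Q y)).idealFunction.zeroSet 1 = Q y := fun y => by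
        rw [zeroSet_basicAlgebra hα 1 (hQ y)]
        exact_mod_cast basicSet_self one_ne_zero (Q y)
      rw [← h y, ← h z]
      exact congrArg (fun A => A.idealFunction.zeroSet 1) hyz
    have hmem : (y : S1) ∈ Q z := hset ▸ Or.inr rfl
    have heq : (y : S1) = (z : S1) := hmem.resolve_left fun h => h (hball y hy)
    have hIco : ∀ y ∈ Ioo 0 (min r (2 * π)), y ∈ Ico 0 (0 + 2 * π) := fun y hy =>
      ⟨hy.1.le, by rw [zero_add]; exact hy.2.trans_le (min_le_right _ _)⟩
    exact (AddCircle.coe_eq_coe_iff_of_mem_Ico (hIco y hy) (hIco z hz)).mp heq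
  have := hmaps.countable_of_injOn hinj hcount
  exact hr0.not_ge (Cardinal.Real.Ioo_countable_iff.mp this)

end Irrational

end RotationAlgebra

end

open RotationAlgebra in
theorem proposition1p7 (α : ℝ) (hα : Irrational (α / (2 * π))) :
    (∀ A : IntermediateAlgebra α, A.IsSmall →
      (∀ n : ℤ, n ≠ 0 → (interior (A.idealFunction.zeroSet n)).Nonempty) ∧ ¬ A.IsResidual) ∧
    (∀ (q : ℕ) (P : Set S1), IsClosed P →
      ((basicAlgebra α q P).IsSmall ↔ ¬ (basicAlgebra α q P).IsResidual)) ∧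
    (∀ (A : IntermediateAlgebra α) (hA : A.IsSmall),
      A.IsFiniteDimensional ∧
      ∀ a : B, a ∈ A.alg ↔
        ∃! η : ℤ → CstarZ α, (∀ n, η n ∈ A.idealFunction.ideal n) ∧
          a = ∑ n ∈ Set.Finite.toFinset hA, e n * (η n : B)) ∧
    ((∀ P : Set S1, IsClosed P → P ≠ Set.univ → P ∪ rot α 1 P = Set.univ →
      (basicAlgebra α 1 P).IsSmall ∧
      Subalgebra.center ℂ (basicAlgebra α 1 P).alg ≠ ⊥ ∧
      Subalgebra.center ℂ (basicAlgebra α 1 P).alg ≠ ⊤) ∧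
    ¬ {A : IntermediateAlgebra α | A.IsSmall ∧ Subalgebra.center ℂ A.alg ≠ ⊥ ∧
      Subalgebra.center ℂ A.alg ≠ ⊤}.Countable) ∧
    (∃ A₁ A₂ : IntermediateAlgebra α, A₁.IsSmall ∧ A₂.IsSmall ∧ ¬ (A₁.join A₂).IsSmall) := by
  refine ⟨fun A hA => ⟨fun n hn => hA.interior_nonempty hα hn, hA.not_isResidual hα⟩,
    fun q P hP => isSmall_basicAlgebra_iff hα q hP,
    fun A hA => ⟨hA.isFiniteDimensional hα, hA.mem_iff hα⟩,
    ⟨fun P hP hne hU => ⟨isSmall_basicAlgebra_one hα hP hU,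
      center_basicAlgebra_ne_bot hα hP hne hU, center_basicAlgebra_ne_top hα hP hne⟩,
      not_countable_isSmall_center hα⟩,
    exists_isSmall_join_not_isSmall hα⟩
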